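/- Let $n\ge 1$ and $m\ge 0$ be integers, and let $A_{n,m}$ be an annulus with $n$ marked points on its outer boundary and $m$ marked points on its inner boundary. View $A_{n,m}$ as a cylinder of height $1$ with universal cover the strip $\mathbb{U}=\mathbb{R}\times[0,1]$; the lower boundary covers the outer boundary, and the outer marked points $1,\dots,n$ lift to the points $((i-1)m,0)$ (to $(i-1,0)$ if $m=0$) and their translates by multiples of $nm$ (of $n$ if $m=0$) in the first coordinate. If $m>0$, the inner marked points lift to the points $(kn,1)$, $k\in\mathbb{Z}$. A (finite) arc of $A_{n,m}$ is a non-contractible curve without self-intersections that joins two (possibly equal) marked points and is not isotopic to a boundary segment; an asymptotic arc (Prüfer or adic arc) is a curve without self-intersections that starts at a marked point and spirals infinitely, in one of the two directions, towards the meridian of the annulus. Arcs are considered up to isotopy fixing their ends. Two arcs are compatible if they have representatives that do not intersect except possibly at their ends. A triangulation $T$ of $A_{n,m}$ is a maximal collection of pairwise compatible (finite or asymptotic) arcs. Its outer quiddity sequence is $(a_1,\dots,a_n)$, where $a_i$ is the number of triangles of the preimage of $T$ in $\mathbb{U}$ that are incident with the lift of the $i$-th outer marked point; the sides of these triangles are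 boundary segments or lifted arcs, and one of the vertices may be one of the two ends $\pm\infty$ of the strip. An infinite frieze is an array $(m_{ij})_{i,j\in\mathbb{Z},\, j\ge i-2}$ of integers with $m_{i,i-2}=0$, $m_{i,i-1}=1$, $m_{ij}>0$ for $i\le j$, and $m_{ij}m_{i+1,j+1}-m_{i+1,j}m_{i,j+1}=1$ for all $j\ge i-1$. Theorem. For every triangulation $T$ of $A_{n,m}$ with outer quiddity sequence $(a_1,\dots,a_n)$ there is an infinite frieze $(m_{ij})$ with $m_{i+n,i+n}=m_{ii}$ for all $i\in\mathbb{Z}$ and $m_{ii}=a_i$ for $1\le i\le n$; that is, $(a_1,\dots,a_n)$ is the quiddity sequence of a periodic infinite frieze. -/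

import Mathlib

open Filter Topology

noncomputable section

namespace AnnulusFrieze

/-! ## Infinite friezes -/

/-- An infinite frieze of positive integers: an array `(F i j)` indexed by pairs with `i - 2 ≤ j`,
with a row of zeros, a row of ones, positive entries below, and the unimodular rule for every
diamond of the array. The values `F i j` with `j < i - 2` play no role. -/
structure IsInfiniteFrieze (F : ℤ → ℤ → ℤ) : Prop where
  zeros : ∀ i, F i (i - 2) = 0
  ones : ∀ i, F i (i - 1) = 1
  pos : ∀ i j, i ≤ j → 0 < F i j
  unimodular : ∀ i j, i - 1 ≤ j → F i j * F (i + 1) (j + 1) - F (i + 1) j * F i (j + 1) = 1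

/-- The tuple `(a 0, …, a (n - 1))`, in the usual numbering `(a_1, …, a_n)`, is the quiddity
sequence of an infinite frieze of period `n`: the quiddity row `i ↦ F i i` has period `n` and
its entries in the positions `1, …, n` are those of the tuple. -/
def DefinesPeriodicInfiniteFrieze {n : ℕ} (a : Fin n → ℕ) : Prop :=
  ∃ F : ℤ → ℤ → ℤ, IsInfiniteFrieze F ∧ (∀ i : ℤ, F (i + n) (i + n) = F i i) ∧
    ∀ i : Fin n, F ((i : ℤ) + 1) ((i : ℤ) + 1) = (a i : ℤ)

/-! ## The annulus and its universal cover

The annulus `A_{n,m}` is the cylinder of height `1` whose circumference is `n * m`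
(`n` if `m = 0`). Its universal cover is the strip `ℝ × [0, 1]`; the lower boundary covers the
outer boundary of the annulus, the upper one the inner boundary. -/

/-- The circumference of the cylinder. -/
def period (n m : ℕ) : ℝ := if m = 0 then (n : ℝ) else (n : ℝ) * m

/-- The covering map from the strip to the cylinder. -/
def cover (n m : ℕ) (p : ℝ × ℝ) : AddCircle (period n m) × ℝ :=
  ((p.1 : AddCircle (period n m)), p.2)

/-- The deck transformation with index `j`. -/
def deck (n m : ℕ) (j : ℤ) (p : ℝ × ℝ) : ℝ × ℝ := (p.1 + j * period n m, p.2)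

/-- The interior of the strip. -/
def openStrip : Set (ℝ × ℝ) := {p | 0 < p.2 ∧ p.2 < 1}

/-- The possible ends of a lifted arc: the marked points on the lower and on the upper boundary
of the strip, and the two ends `±∞` of the strip, to which the lifts of curves that spiral
infinitely around the meridian tend. -/
inductive Vertex : Type
  | lower (k : ℤ)
  | upper (k : ℤ)
  | posInf
  | negInf

namespace Vertex

/-- `v` is a marked point of the strip (there are none on the upper boundary if `m = 0`). -/
def IsMarked (m : ℕ) : Vertex → Prop
  | lower _ => True
  | upper _ => m ≠ 0
  | posInf => False
  | negInf => False

/-- `v` is one of the two ends `±∞` of the strip. -/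
def IsInfinite : Vertex → Prop
  | lower _ => False
  | upper _ => False
  | posInf => True
  | negInf => True

/-- The filter of neighbourhoods of `v` in the strip. The lower marked points are the points
`(k m, 0)`, or `(k, 0)` if `m = 0`; the upper ones are the points `(k n, 1)`. Near `±∞` the first
coordinate tends to `±∞` and the height to that of the meridian, `1 / 2`. -/
def toFilter (n m : ℕ) : Vertex → Filter (ℝ × ℝ)
  | lower k => 𝓝 ((k : ℝ) * (if m = 0 then 1 else (m : ℝ)), 0)
  | upper k => 𝓝 ((k : ℝ) * n, 1)
  | posInf => atTop ×ˢ 𝓝 (1 / 2)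
  | negInf => atBot ×ˢ 𝓝 (1 / 2)

/-- The action of the deck transformation with index `j` on the ends. -/
def shift (n m : ℕ) (j : ℤ) : Vertex → Vertex
  | lower k => lower (k + j * n)
  | upper k => upper (k + j * m)
  | posInf => posInf
  | negInf => negInf

end Vertex

/-- `v` and `w` are consecutive marked points on the same boundary component of the strip, that
is, the ends of a (lifted) boundary segment. -/
def BoundarySegment (m : ℕ) : Vertex → Vertex → Prop
  | Vertex.lower k, Vertex.lower l => l = k + 1 ∨ k = l + 1
  | Vertex.upper k, Vertex.upper l => m ≠ 0 ∧ (l = k + 1 ∨ k = l + 1)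
  | _, _ => False

/-! ## Curves and arcs -/

/-- A curve in the annulus that represents an arc, given by a lift to the strip. The curve
without its ends is parametrized by `ℝ` and runs in the interior of the strip, from `src` to
`tgt`; its image in the annulus has no self-intersections (the two ends may coincide there).

It joins two marked points (a finite arc), or a marked point with `±∞` (an asymptotic arc: a
Prüfer or an adic arc). It is not contractible, so its lift is not closed, and it does not join
two consecutive marked points of the same boundary component of the strip, so it is not
homotopic to a boundary segment. -/
structure Curve (n m : ℕ) where
  src : Vertex
  tgt : Vertex
  toFun : ℝ → ℝ × ℝ
  continuous_toFun : Continuous toFun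
  mem_openStrip : ∀ t, toFun t ∈ openStrip
  tendsto_src : Tendsto toFun atBot (src.toFilter n m)
  tendsto_tgt : Tendsto toFun atTop (tgt.toFilter n m)
  ends : (src.IsMarked m ∧ tgt.IsMarked m) ∨ (src.IsMarked m ∧ tgt.IsInfinite) ∨
    (src.IsInfinite ∧ tgt.IsMarked m)
  not_closed : src ≠ tgt
  not_boundary : ¬ BoundarySegment m src tgt
  simple : Function.Injective (fun t => cover n m (toFun t))

/-- `γ` and `δ`, curves in the strip that run from `v` to `w`, are homotopic through such curves,
with fixed ends (the convergence to the ends is uniform in the homotopy parameter). For curves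
without self-intersections on a surface this is the same as isotopy with fixed ends. -/
def HomotopicRel (n m : ℕ) (v w : Vertex) (γ δ : ℝ → ℝ × ℝ) : Prop :=
  ∃ H : unitInterval × ℝ → ℝ × ℝ, Continuous H ∧ (∀ p, H p ∈ openStrip) ∧
    (∀ t, H (0, t) = γ t) ∧ (∀ t, H (1, t) = δ t) ∧
    Tendsto H (⊤ ×ˢ atBot) (v.toFilter n m) ∧ Tendsto H (⊤ ×ˢ atTop) (w.toFilter n m)

/-- Two curves represent the same (unoriented) arc of the annulus: up to a deck transformation and
up to reversal of one of them their lifts are homotopic with fixed ends. -/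
def Curve.Equivalent {n m : ℕ} (c d : Curve n m) : Prop :=
  ∃ j : ℤ,
    (c.src = d.src.shift n m j ∧ c.tgt = d.tgt.shift n m j ∧
      HomotopicRel n m c.src c.tgt c.toFun (fun t => deck n m j (d.toFun t))) ∨
    (c.src = d.tgt.shift n m j ∧ c.tgt = d.src.shift n m j ∧
      HomotopicRel n m c.src c.tgt c.toFun (fun t => deck n m j (d.toFun (-t))))

/-! ### `Curve.Equivalent` is an equivalence relation -/

theorem tendsto_of_mem_uIcc {α : Type*} {a : Filter α} {l : Filter ℝ}
    [TendstoIxxClass Set.Icc l l] {f g h : α → ℝ} (hf : Tendsto f a l) (hg : Tendsto g a l)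
    (hh : ∀ x, h x ∈ Set.uIcc (f x) (g x)) : Tendsto h a l := by
  intro s hs
  have hfg := tendsto_smallSets_iff.1 (hf.uIcc hg) s hs
  exact hfg.mono fun x hx => hx (hh x)

theorem tendsto_segment {α : Type*} {n m : ℕ} {a : Filter α} (v : Vertex) {f g h : α → ℝ × ℝ}
    (hf : Tendsto f a (v.toFilter n m)) (hg : Tendsto g a (v.toFilter n m))
    (h1 : ∀ x, (h x).1 ∈ Set.uIcc (f x).1 (g x).1)
    (h2 : ∀ x, (h x).2 ∈ Set.uIcc (f x).2 (g x).2) : Tendsto h a (v.toFilter n m) := by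
  cases v <;> simp only [Vertex.toFilter, nhds_prod_eq, tendsto_prod_iff'] at hf hg ⊢ <;>
    exact ⟨tendsto_of_mem_uIcc hf.1 hg.1 h1, tendsto_of_mem_uIcc hf.2 hg.2 h2⟩

theorem mem_uIcc_segment (s : unitInterval) (a b : ℝ) :
    (1 - (s : ℝ)) * a + s * b ∈ Set.uIcc a b := by
  rw [← segment_eq_uIcc]
  exact ⟨1 - s, s, sub_nonneg.2 s.2.2, s.2.1, by ring, by simp⟩

/-- The strip is convex: any two curves with the same ends are homotopic. -/
theorem homotopicRel_of_ends {n m : ℕ} {v w : Vertex} {γ δ : ℝ → ℝ × ℝ}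
    (hγ : Continuous γ) (hδ : Continuous δ)
    (hγs : ∀ t, γ t ∈ openStrip) (hδs : ∀ t, δ t ∈ openStrip)
    (hγv : Tendsto γ atBot (v.toFilter n m)) (hδv : Tendsto δ atBot (v.toFilter n m))
    (hγw : Tendsto γ atTop (w.toFilter n m)) (hδw : Tendsto δ atTop (w.toFilter n m)) :
    HomotopicRel n m v w γ δ := by
  refine ⟨fun p => ((1 - (p.1 : ℝ)) * (γ p.2).1 + p.1 * (δ p.2).1,
    (1 - (p.1 : ℝ)) * (γ p.2).2 + p.1 * (δ p.2).2), by fun_prop, ?_, by simp, by simp, ?_, ?_⟩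
  · intro p
    have h := mem_uIcc_segment p.1 (γ p.2).2 (δ p.2).2
    have h' : Set.uIcc (γ p.2).2 (δ p.2).2 ⊆ Set.Ioo (0 : ℝ) 1 :=
      Set.OrdConnected.uIcc_subset Set.ordConnected_Ioo (hγs p.2) (hδs p.2)
    exact h' h
  · exact tendsto_segment v (hγv.comp tendsto_snd) (hδv.comp tendsto_snd)
      (fun p => mem_uIcc_segment _ _ _) (fun p => mem_uIcc_segment _ _ _)
  · exact tendsto_segment w (hγw.comp tendsto_snd) (hδw.comp tendsto_snd)
      (fun p => mem_uIcc_segment _ _ _) (fun p => mem_uIcc_segment _ _ _)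

theorem continuous_deck (n m : ℕ) (j : ℤ) : Continuous (deck n m j) := by
  unfold deck; fun_prop

theorem tendsto_deck (n m : ℕ) (j : ℤ) {v : Vertex} (hv : v.IsMarked m ∨ v.IsInfinite) :
    Tendsto (deck n m j) (v.toFilter n m) ((v.shift n m j).toFilter n m) := by
  cases v with
  | lower k =>
    refine (continuous_deck n m j).tendsto' _ _ ?_
    by_cases h : m = 0 <;> simp [deck, period, h]
    ring
  | upper k =>
    have h : m ≠ 0 := by simpa [Vertex.IsMarked, Vertex.IsInfinite] using hv
    refine (continuous_deck n m j).tendsto' _ _ ?_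
    simp [deck, period, h]
    ring
  | posInf =>
    exact (tendsto_atTop_add_const_right _ _ tendsto_fst).prodMk tendsto_snd
  | negInf =>
    exact (tendsto_atBot_add_const_right _ _ tendsto_fst).prodMk tendsto_snd

theorem Vertex.shift_shift (n m : ℕ) (i j : ℤ) (v : Vertex) :
    (v.shift n m i).shift n m j = v.shift n m (i + j) := by
  cases v <;> simp [Vertex.shift] <;> ring

theorem Vertex.shift_zero (n m : ℕ) (v : Vertex) : v.shift n m 0 = v := by
  cases v <;> simp [Vertex.shift]

theorem Vertex.eq_shift_iff (n m : ℕ) (j : ℤ) (v w : Vertex) :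
    v = w.shift n m j ↔ w = v.shift n m (-j) := by
  constructor <;> rintro rfl <;> simp [Vertex.shift_shift, Vertex.shift_zero]

theorem Curve.src_valid {n m : ℕ} (c : Curve n m) : c.src.IsMarked m ∨ c.src.IsInfinite := by
  rcases c.ends with h | h | h <;> simp [h]

theorem Curve.tgt_valid {n m : ℕ} (c : Curve n m) : c.tgt.IsMarked m ∨ c.tgt.IsInfinite := by
  rcases c.ends with h | h | h <;> simp [h]

/-- Curves represent the same arc if and only if their ends agree up to a deck transformation and
up to reversal. -/
theorem Curve.equivalent_iff {n m : ℕ} (c d : Curve n m) :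
    c.Equivalent d ↔ ∃ j : ℤ, (c.src = d.src.shift n m j ∧ c.tgt = d.tgt.shift n m j) ∨
      (c.src = d.tgt.shift n m j ∧ c.tgt = d.src.shift n m j) := by
  refine exists_congr fun j => or_congr ?_ ?_
  · refine ⟨fun h => ⟨h.1, h.2.1⟩, fun h => ⟨h.1, h.2, ?_⟩⟩
    refine homotopicRel_of_ends c.continuous_toFun
      ((continuous_deck n m j).comp d.continuous_toFun) c.mem_openStrip
      (fun t => d.mem_openStrip t) c.tendsto_src ?_ c.tendsto_tgt ?_
    · rw [h.1]; exact (tendsto_deck n m j d.src_valid).comp d.tendsto_src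
    · rw [h.2]; exact (tendsto_deck n m j d.tgt_valid).comp d.tendsto_tgt
  · refine ⟨fun h => ⟨h.1, h.2.1⟩, fun h => ⟨h.1, h.2, ?_⟩⟩
    refine homotopicRel_of_ends c.continuous_toFun
      ((continuous_deck n m j).comp (d.continuous_toFun.comp continuous_neg)) c.mem_openStrip
      (fun t => d.mem_openStrip (-t)) c.tendsto_src ?_ c.tendsto_tgt ?_
    · rw [h.1]
      exact (tendsto_deck n m j d.tgt_valid).comp (d.tendsto_tgt.comp tendsto_neg_atBot_atTop)
    · rw [h.2]
      exact (tendsto_deck n m j d.src_valid).comp (d.tendsto_src.comp tendsto_neg_atTop_atBot)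

theorem Curve.equivalence (n m : ℕ) : Equivalence (Curve.Equivalent (n := n) (m := m)) where
  refl c := (c.equivalent_iff c).2 ⟨0, by simp [Vertex.shift_zero]⟩
  symm := by
    intro c d h
    rw [Curve.equivalent_iff] at h ⊢
    obtain ⟨j, h⟩ := h
    refine ⟨-j, ?_⟩
    rcases h with ⟨h1, h2⟩ | ⟨h1, h2⟩ <;> rw [Vertex.eq_shift_iff] at h1 h2
    · exact Or.inl ⟨h1, h2⟩
    · exact Or.inr ⟨h2, h1⟩
  trans := by
    intro c d e h h'
    rw [Curve.equivalent_iff] at h h' ⊢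
    obtain ⟨j, h⟩ := h
    obtain ⟨k, h'⟩ := h'
    refine ⟨k + j, ?_⟩
    rcases h with ⟨h1, h2⟩ | ⟨h1, h2⟩ <;> rcases h' with ⟨h3, h4⟩ | ⟨h3, h4⟩ <;>
      simp [h1, h2, h3, h4, Vertex.shift_shift]

instance curveSetoid (n m : ℕ) : Setoid (Curve n m) := ⟨Curve.Equivalent, Curve.equivalence n m⟩

/-! ## Triangulations and their quiddity sequences -/

/-- The arcs of the annulus `A_{n,m}`, finite and asymptotic ones: classes of curves. -/
def Arc (n m : ℕ) : Type := Quotient (curveSetoid n m)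

/-- The arc represented by a curve. -/
def Curve.toArc {n m : ℕ} (c : Curve n m) : Arc n m := Quotient.mk (curveSetoid n m) c

/-- Two arcs are compatible if they have representatives that do not intersect in the annulus
(except possibly at their ends). -/
def Compatible {n m : ℕ} (A B : Arc n m) : Prop :=
  ∃ c d : Curve n m, c.toArc = A ∧ d.toArc = B ∧
    ∀ s t, cover n m (c.toFun s) ≠ cover n m (d.toFun t)

/-- A triangulation is a maximal collection of pairwise compatible arcs. -/
def IsTriangulation {n m : ℕ} (T : Set (Arc n m)) : Prop :=
  Maximal (fun S : Set (Arc n m) => S.Pairwise Compatible) T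

/-- `v` and `w` are joined by a boundary segment of the strip or by an arc of the preimage of `T`
in the strip. -/
def Joined {n m : ℕ} (T : Set (Arc n m)) (v w : Vertex) : Prop :=
  BoundarySegment m v w ∨ ∃ c : Curve n m, c.toArc ∈ T ∧ c.src = v ∧ c.tgt = w

/-- The triangles of the preimage of `T` in the strip that are incident with `v`. The sides of a
triangle are boundary segments or arcs of the preimage of `T`, and since the strip is simply
connected, a triangle is given by the set of its three vertices. One of them can be `±∞`. -/
def trianglesAt {n m : ℕ} (T : Set (Arc n m)) (v : Vertex) : Set (Finset Vertex) :=
  {t | t.card = 3 ∧ v ∈ t ∧ (t : Set Vertex).Pairwise (Joined T)}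

/-- The outer quiddity sequence `(a_1, …, a_n)` of `T`: the entry `a_i` is the number of triangles
incident with the `i`-th outer marked point, in the universal cover. -/
def quiddity {n m : ℕ} (T : Set (Arc n m)) (i : Fin n) : ℕ :=
  (trianglesAt T (Vertex.lower (i : ℕ))).ncard

end AnnulusFrieze

end

noncomputable section

namespace AnnulusFrieze

/-! Lifts of two noncrossing arcs never separate each other's ends, since separated curves in the
strip meet. Conversely, identify the strip with the upper half-plane: geodesics whose ends do not
separate each other are disjoint, so by maximality a triangulation contains every arc that none of
its arcs crosses.

Give each marked point of the lower boundary the weight `1` if no arc passes over it, and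
otherwise the sum of the weights of the ends of the shortest arc that passes over it. Then the
middle vertex of a triangle with vertices on the lower boundary weighs as much as the two others
together, and telescoping over the fan of triangles at `p` gives
`w (p - 1) + w (p + 1) ≤ a p * w p`. A positive supersolution of this recursion forces all
continuants of `a` to be positive, and these continuants form the frieze. -/

/-! ## The Poincaré–Miranda theorem and curves that meet -/

theorem abs_lt_of_forall_cos_pos {θ : ℝ → ℝ} (hθ : Continuous θ) {s t : ℝ}
    (hs : |θ s| < Real.pi / 2) (h : ∀ r ∈ Set.uIcc s t, 0 < Real.cos (θ r)) :
    |θ t| < Real.pi / 2 := by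
  by_contra! ht
  obtain ⟨r, hr, hr'⟩ := intermediate_value_uIcc (hθ.abs.continuousOn (s := Set.uIcc s t))
    (Set.mem_uIcc.2 (Or.inl ⟨hs.le, ht⟩))
  refine (h r hr).ne' ?_
  rw [← Real.cos_abs]
  exact (congrArg Real.cos hr').trans Real.cos_pi_div_two

theorem abs_sub_lt_of_quarter_turn {θ : ℝ → ℝ} (hθ : Continuous θ) {s t α : ℝ}
    (hs : |θ s - α| < Real.pi / 2)
    (h : ∀ r ∈ Set.uIcc s t, 0 < Real.cos (θ r - (α + Real.pi / 2))) :
    |θ t - (α + Real.pi / 2)| < Real.pi / 2 := by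
  refine abs_lt_of_forall_cos_pos (θ := fun r => θ r - (α + Real.pi / 2)) (by fun_prop) ?_ h
  have hcos := h s Set.left_mem_uIcc
  rw [abs_lt] at hs ⊢
  refine ⟨?_, by linarith⟩
  by_contra! hle
  rw [← Real.cos_neg] at hcos
  exact hcos.not_ge (Real.cos_nonpos_of_pi_div_two_le_of_le (by linarith) (by linarith))

theorem exists_continuous_angle {X : Type*} [TopologicalSpace X] [SimplyConnectedSpace X]
    [LocallyPathConnectedSpace X] (F : C(X, ℂ)) (hF : ∀ x, F x ≠ 0) (x₀ : X) :
    ∃ θ : X → ℝ, Continuous θ ∧ θ x₀ = (F x₀).arg ∧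
      (∀ x, (F x).re = ‖F x‖ * Real.cos (θ x)) ∧ ∀ x, (F x).im = ‖F x‖ * Real.sin (θ x) := by
  obtain ⟨G, ⟨hG₀, hG⟩, -⟩ := Complex.isCoveringMapOn_exp.existsUnique_continuousMap_lifts F
    (a₀ := x₀) (e₀ := Complex.log (F x₀)) (Complex.exp_log (hF _)) hF
  have hexp : ∀ x, F x = Complex.exp (G x) := fun x => (congrFun hG x).symm
  refine ⟨fun x => (G x).im, by fun_prop, by simp only [hG₀, Complex.log_im],
    fun x => ?_, fun x => ?_⟩
  · rw [hexp, Complex.norm_exp, Complex.exp_re]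
  · rw [hexp, Complex.norm_exp, Complex.exp_im]

theorem not_forall_boundary_quarter_turns {θ : ℝ × ℝ → ℝ} (hθ : Continuous θ) {a b c d : ℝ}
    (start : |θ (b, c)| < Real.pi / 2)
    (bottom : ∀ s ∈ Set.uIcc b a, 0 < Real.sin (θ (s, c)))
    (left : ∀ t ∈ Set.uIcc c d, Real.cos (θ (a, t)) < 0)
    (top : ∀ s ∈ Set.uIcc a b, Real.sin (θ (s, d)) < 0)
    (right : ∀ t ∈ Set.uIcc d c, 0 < Real.cos (θ (b, t))) : False := by
  have alongBottom := abs_sub_lt_of_quarter_turn (θ := fun s => θ (s, c)) (α := 0)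
    (by fun_prop) (by rwa [sub_zero]) fun s hs => by
      rw [zero_add, Real.cos_sub_pi_div_two]; exact bottom s hs
  have alongLeft := abs_sub_lt_of_quarter_turn (θ := fun t => θ (a, t))
    (by fun_prop) alongBottom fun t ht => by
      rw [zero_add, add_halves, Real.cos_sub_pi, neg_pos]; exact left t ht
  have alongTop := abs_sub_lt_of_quarter_turn (θ := fun s => θ (s, d))
    (by fun_prop) alongLeft fun s hs => by
      rw [zero_add, add_halves, ← sub_sub, Real.cos_sub_pi_div_two, Real.sin_sub_pi, neg_pos]
      exact top s hs
  have alongRight := abs_sub_lt_of_quarter_turn (θ := fun t => θ (b, t))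
    (by fun_prop) alongTop fun t ht => by
      rw [zero_add, add_halves, add_assoc, add_halves, ← two_mul, Real.cos_sub_two_pi]
      exact right t ht
  rw [abs_lt] at start alongRight
  linarith [Real.pi_pos]

theorem exists_zero_of_sign_change {f g : ℝ × ℝ → ℝ} (hf : Continuous f) (hg : Continuous g)
    {a b c d : ℝ} (hab : a ≤ b) (hcd : c ≤ d)
    (left : ∀ t ∈ Set.Icc c d, f (a, t) < 0) (right : ∀ t ∈ Set.Icc c d, 0 < f (b, t))
    (bottom : ∀ s ∈ Set.Icc a b, 0 < g (s, c)) (top : ∀ s ∈ Set.Icc a b, g (s, d) < 0) :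
    ∃ p : ℝ × ℝ, f p = 0 ∧ g p = 0 := by
  by_contra! hne
  let ρ : ℝ × ℝ → ℝ × ℝ := fun p => (Set.projIcc a b hab p.1, Set.projIcc c d hcd p.2)
  have hρ : ∀ s ∈ Set.Icc a b, ∀ t ∈ Set.Icc c d, ρ (s, t) = (s, t) := fun s hs t ht => by
    simp only [ρ, Set.projIcc_of_mem hab hs, Set.projIcc_of_mem hcd ht]
  let F : C(ℝ × ℝ, ℂ) := ⟨fun p => f (ρ p) + g (ρ p) * Complex.I, by fun_prop⟩
  have hFre : ∀ p, (F p).re = f (ρ p) := fun p => by simp [F]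
  have hFim : ∀ p, (F p).im = g (ρ p) := fun p => by simp [F]
  have hF : ∀ p, F p ≠ 0 := fun p h =>
    hne (ρ p) (by rw [← hFre, h, Complex.zero_re]) (by rw [← hFim, h, Complex.zero_im])
  have ha := Set.left_mem_Icc.2 hab
  have hb := Set.right_mem_Icc.2 hab
  have hc := Set.left_mem_Icc.2 hcd
  have hd := Set.right_mem_Icc.2 hcd
  obtain ⟨θ, hθ, hstart, hcos, hsin⟩ := exists_continuous_angle F hF (b, c)
  simp only [hFre, hFim] at hcos hsin
  refine not_forall_boundary_quarter_turns (a := a) (b := b) (c := c) (d := d) hθ ?_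
    (fun s hs => ?_) (fun t ht => ?_) (fun s hs => ?_) (fun t ht => ?_)
  · rw [hstart, Complex.abs_arg_lt_pi_div_two_iff, hFre, hρ b hb c hc]
    exact Or.inl (right c hc)
  · rw [Set.uIcc_of_ge hab] at hs
    refine pos_of_mul_pos_right ?_ (norm_nonneg (F (s, c)))
    rw [← hsin, hρ s hs c hc]; exact bottom s hs
  · rw [Set.uIcc_of_le hcd] at ht
    refine neg_of_mul_neg_right ?_ (norm_nonneg (F (a, t)))
    rw [← hcos, hρ a ha t ht]; exact left t ht
  · rw [Set.uIcc_of_le hab] at hs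
    refine neg_of_mul_neg_right ?_ (norm_nonneg (F (s, d)))
    rw [← hsin, hρ s hs d hd]; exact top s hs
  · rw [Set.uIcc_of_ge hcd] at ht
    refine pos_of_mul_pos_right ?_ (norm_nonneg (F (b, t)))
    rw [← hcos, hρ b hb t ht]; exact right t ht

theorem exists_eq_of_crossing_strip {γ δ : ℝ → ℝ × ℝ} (hγ : Continuous γ) (hδ : Continuous δ)
    {p q x y : ℝ} (hγpq : ∀ t, (γ t).2 ∈ Set.Ioo p q)
    (hγbot : Tendsto (fun t => (γ t).1) atBot atBot)
    (hγtop : Tendsto (fun t => (γ t).1) atTop atTop)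
    (hδbot : Tendsto δ atBot (𝓝 (x, p))) (hδtop : Tendsto δ atTop (𝓝 (y, q))) :
    ∃ s t, γ s = δ t := by
  have hδ1 : Continuous fun t => (δ t).1 := by fun_prop
  obtain ⟨R, -, hR⟩ := (hδ1.isBounded_range_iff_isBigO_atTop_atBot.2
    ⟨hδtop.fst_nhds.isBigO_one ℝ, hδbot.fst_nhds.isBigO_one ℝ⟩).exists_pos_norm_lt
  have hR' : ∀ t, -R < (δ t).1 ∧ (δ t).1 < R := fun t => abs_lt.1 (hR _ ⟨t, rfl⟩)
  obtain ⟨a, ha, ha0⟩ := ((hγbot.eventually_le_atBot (-R)).and (eventually_le_atBot 0)).exists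
  obtain ⟨b, hb, hb0⟩ := ((hγtop.eventually_ge_atTop R).and (eventually_ge_atTop 0)).exists
  have hab : a ≤ b := ha0.trans hb0
  have hγ2 : Continuous fun s => (γ s).2 := by fun_prop
  obtain ⟨lo, -, hlo⟩ :=
    isCompact_Icc.exists_isMinOn (Set.nonempty_Icc.2 hab) hγ2.continuousOn
  obtain ⟨hi, -, hhi⟩ :=
    isCompact_Icc.exists_isMaxOn (Set.nonempty_Icc.2 hab) hγ2.continuousOn
  obtain ⟨c, hc, hc0⟩ := ((hδbot.snd_nhds.eventually (gt_mem_nhds (hγpq lo).1)).and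
    (eventually_le_atBot 0)).exists
  obtain ⟨d, hd, hd0⟩ := ((hδtop.snd_nhds.eventually (lt_mem_nhds (hγpq hi).2)).and
    (eventually_ge_atTop 0)).exists
  obtain ⟨⟨s, t⟩, h₁, h₂⟩ := exists_zero_of_sign_change
    (f := fun z => (γ z.1).1 - (δ z.2).1) (g := fun z => (γ z.1).2 - (δ z.2).2)
    (by fun_prop) (by fun_prop) hab (hc0.trans hd0)
    (fun t _ => sub_neg.2 (ha.trans_lt (hR' t).1)) (fun t _ => sub_pos.2 ((hR' t).2.trans_le hb))
    (fun s hs => sub_pos.2 (hc.trans_le (hlo hs)))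
    (fun s hs => sub_neg.2 (lt_of_le_of_lt (hhi hs) hd))
  exact ⟨s, t, Prod.ext (sub_eq_zero.1 h₁) (sub_eq_zero.1 h₂)⟩

/-! ## The strip and the upper half plane -/

/-- The conformal map from the strip to the upper half plane. The lower boundary becomes the
positive, the upper boundary the negative real axis, and the ends `∞` and `-∞` of the strip become
`∞` and `0`. -/
def toHalfPlane (p : ℝ × ℝ) : ℂ := Complex.exp (Real.pi * (p.1 + p.2 * Complex.I))

/-- The inverse of `toHalfPlane`, extended to the boundary `ℝ \ {0}` of the half plane. -/
def ofHalfPlane (w : ℂ) : ℝ × ℝ := (Real.log ‖w‖ / Real.pi, w.arg / Real.pi)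

theorem continuous_toHalfPlane : Continuous toHalfPlane := by
  unfold toHalfPlane; fun_prop

theorem toHalfPlane_im_pos {p : ℝ × ℝ} (hp : p ∈ openStrip) : 0 < (toHalfPlane p).im := by
  have him : (toHalfPlane p).im = Real.exp (Real.pi * p.1) * Real.sin (Real.pi * p.2) := by
    rw [toHalfPlane, Complex.exp_im]; simp
  rw [him]
  exact mul_pos (Real.exp_pos _) (Real.sin_pos_of_pos_of_lt_pi (mul_pos Real.pi_pos hp.1)
    (mul_lt_of_lt_one_right Real.pi_pos hp.2))

theorem toHalfPlane_ofHalfPlane {w : ℂ} (hw : w ≠ 0) : toHalfPlane (ofHalfPlane w) = w := by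
  conv_rhs => rw [← Complex.exp_log hw]
  have hπ : (Real.pi : ℂ) ≠ 0 := by exact_mod_cast Real.pi_ne_zero
  rw [toHalfPlane, ofHalfPlane, Complex.log]
  push_cast
  congr 1
  field_simp

theorem ofHalfPlane_toHalfPlane {p : ℝ × ℝ} (hp : p ∈ openStrip) :
    ofHalfPlane (toHalfPlane p) = p := by
  have hπ := Real.pi_pos
  have him : (Real.pi * (p.1 + p.2 * Complex.I) : ℂ).im = Real.pi * p.2 := by simp
  have hlog : Complex.log (toHalfPlane p) = Real.pi * (p.1 + p.2 * Complex.I) :=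
    Complex.log_exp (by rw [him]; linarith [mul_pos hπ hp.1])
      (by rw [him]; exact (mul_lt_of_lt_one_right hπ hp.2).le)
  ext
  · rw [ofHalfPlane, ← Complex.log_re, hlog]; simp [hπ.ne']
  · rw [ofHalfPlane, ← Complex.log_im, hlog]; simp [hπ.ne']

theorem ofHalfPlane_injOn : Set.InjOn ofHalfPlane {0}ᶜ := fun w hw z hz h => by
  rw [← toHalfPlane_ofHalfPlane hw, h, toHalfPlane_ofHalfPlane hz]

theorem ofHalfPlane_mem_openStrip {w : ℂ} (hw : 0 < w.im) : ofHalfPlane w ∈ openStrip := by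
  have h0 : w.arg ≠ 0 := fun h => hw.ne' (Complex.arg_eq_zero_iff.1 h).2
  have h1 : w.arg ≠ Real.pi := fun h => hw.ne' (Complex.arg_eq_pi_iff.1 h).2
  exact ⟨div_pos ((Complex.arg_nonneg_iff.2 hw.le).lt_of_ne h0.symm) Real.pi_pos,
    (div_lt_one Real.pi_pos).2 ((Complex.arg_le_pi w).lt_of_ne h1)⟩

theorem continuousWithinAt_ofHalfPlane {w : ℂ} (hw : w ≠ 0) :
    ContinuousWithinAt ofHalfPlane {z | 0 ≤ z.im} w := by
  have harg : ContinuousWithinAt Complex.arg {z | 0 ≤ z.im} w := by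
    by_cases h : w ∈ Complex.slitPlane
    · exact (Complex.continuousAt_arg h).continuousWithinAt
    · have h' : w.re ≤ 0 ∧ w.im = 0 := by
        simpa [Complex.mem_slitPlane_iff, not_or] using h
      refine Complex.continuousWithinAt_arg_of_re_neg_of_im_zero (h'.1.lt_of_ne fun h0 => ?_) h'.2
      exact hw (Complex.ext h0 h'.2)
  have hlog : ContinuousWithinAt (fun z : ℂ => Real.log ‖z‖) {z | 0 ≤ z.im} w :=
    (continuousWithinAt_id.norm).log (norm_ne_zero_iff.2 hw)
  exact (hlog.div_const _).prodMk (harg.div_const _)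

theorem tendsto_ofHalfPlane {α : Type*} {l : Filter α} {f : α → ℂ} {w : ℂ} (hw : w ≠ 0)
    (hf : Tendsto f l (𝓝 w)) (him : ∀ a, 0 < (f a).im) :
    Tendsto (fun a => ofHalfPlane (f a)) l (𝓝 (ofHalfPlane w)) :=
  (continuousWithinAt_ofHalfPlane hw).tendsto.comp
    (tendsto_nhdsWithin_iff.2 ⟨hf, Eventually.of_forall fun a => (him a).le⟩)

theorem continuous_ofHalfPlane_comp {f : ℝ → ℂ} (hf : Continuous f) (him : ∀ t, 0 < (f t).im) :
    Continuous fun t => ofHalfPlane (f t) :=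
  continuous_iff_continuousAt.2 fun t => tendsto_ofHalfPlane
    (fun h => (him t).ne' (by rw [h, Complex.zero_im])) (hf.tendsto t) him

theorem ofHalfPlane_ofReal_pos {x : ℝ} (hx : 0 < x) :
    ofHalfPlane x = (Real.log x / Real.pi, 0) := by
  rw [ofHalfPlane, Complex.norm_of_nonneg hx.le, Complex.arg_ofReal_of_nonneg hx.le, zero_div]

theorem ofHalfPlane_ofReal_neg {x : ℝ} (hx : x < 0) :
    ofHalfPlane x = (Real.log (-x) / Real.pi, 1) := by
  rw [ofHalfPlane, Complex.norm_real, Real.norm_of_nonpos hx.le, Complex.arg_ofReal_of_neg hx,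
    div_self Real.pi_ne_zero]

theorem ofHalfPlane_ofReal_mul_I {c : ℝ} (hc : 0 < c) :
    ofHalfPlane (c * Complex.I) = (Real.log c / Real.pi, 1 / 2) := by
  rw [ofHalfPlane, Complex.arg_real_mul _ hc, Complex.arg_I, norm_mul,
    Complex.norm_of_nonneg hc.le, Complex.norm_I, mul_one]
  congr 1
  field_simp [Real.pi_ne_zero]

theorem ofHalfPlane_exp_mul (r : ℝ) {w : ℂ} (hw : w ≠ 0) :
    ofHalfPlane (Real.exp r * w) = ((ofHalfPlane w).1 + r / Real.pi, (ofHalfPlane w).2) := by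
  have hr := Real.exp_pos r
  rw [ofHalfPlane, ofHalfPlane, Complex.arg_real_mul _ hr, norm_mul, Complex.norm_of_nonneg hr.le,
    Real.log_mul hr.ne' (norm_ne_zero_iff.2 hw), Real.log_exp, add_div, add_comm]

theorem exists_eq_of_crossing_halfPlane {γ δ : ℝ → ℂ} (hγ : Continuous γ) (hδ : Continuous δ)
    (hγi : ∀ t, 0 < (γ t).im) (hδi : ∀ t, 0 < (δ t).im)
    (hγbot : Tendsto γ atBot (𝓝 0)) (hγtop : Tendsto (fun t => (γ t)⁻¹) atTop (𝓝 0))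
    {b d : ℝ} (hbd : b * d < 0) (hδbot : Tendsto δ atBot (𝓝 b)) (hδtop : Tendsto δ atTop (𝓝 d)) :
    ∃ s t, γ s = δ t := by
  wlog hb : 0 < b generalizing δ b d
  · have hd : 0 < d := by
      by_contra! hd
      exact hbd.not_ge (mul_nonneg_of_nonpos_of_nonpos (not_lt.1 hb) hd)
    obtain ⟨s, t, h⟩ := this (δ := fun t => δ (-t)) (by fun_prop) (fun t => hδi _)
      (by rwa [mul_comm]) (hδtop.comp tendsto_neg_atBot_atTop)
      (hδbot.comp tendsto_neg_atTop_atBot) hd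
    exact ⟨s, -t, h⟩
  have hd : d < 0 := neg_of_mul_neg_right hbd hb.le
  have hγ0 : ∀ t, γ t ≠ 0 := fun t h => (hγi t).ne' (by rw [h, Complex.zero_im])
  have hδ0 : ∀ t, δ t ≠ 0 := fun t h => (hδi t).ne' (by rw [h, Complex.zero_im])
  have hlogBot : Tendsto (fun t => Real.log ‖γ t‖) atBot atBot :=
    Real.tendsto_log_nhdsNE_zero.comp (tendsto_nhdsWithin_iff.2
      ⟨by simpa only [norm_zero] using hγbot.norm, Eventually.of_forall fun t => by simp [hγ0 t]⟩)
  have hlogTop : Tendsto (fun t => Real.log ‖γ t‖) atTop atTop := by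
    have h := tendsto_neg_atBot_atTop.comp (Real.tendsto_log_nhdsNE_zero.comp
      (tendsto_nhdsWithin_iff.2 ⟨by simpa only [norm_zero] using hγtop.norm,
        Eventually.of_forall fun t => by simp [hγ0 t]⟩))
    exact h.congr fun t => by simp
  have hbot := tendsto_ofHalfPlane (Complex.ofReal_ne_zero.2 hb.ne') hδbot hδi
  have htop := tendsto_ofHalfPlane (Complex.ofReal_ne_zero.2 hd.ne) hδtop hδi
  rw [ofHalfPlane_ofReal_pos hb] at hbot
  rw [ofHalfPlane_ofReal_neg hd] at htop
  obtain ⟨s, t, h⟩ := exists_eq_of_crossing_strip (continuous_ofHalfPlane_comp hγ hγi)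
    (continuous_ofHalfPlane_comp hδ hδi) (fun t => ofHalfPlane_mem_openStrip (hγi t))
    (hlogBot.atBot_div_const Real.pi_pos) (hlogTop.atTop_div_const Real.pi_pos) hbot htop
  exact ⟨s, t, ofHalfPlane_injOn (hγ0 s) (hδ0 t) h⟩

/-! ## Curves and geodesics of the half plane with ends on the projective line -/

/-- The determinant of the homogeneous coordinates of two points of the real projective line, the
boundary of the upper half plane. -/
def det (u v : ℝ × ℝ) : ℝ := u.1 * v.2 - v.1 * u.2

/-- The cross term of four points of the projective line: it is negative if and only if `u`, `v`
separate `x`, `y`. -/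
def crossing (u v x y : ℝ × ℝ) : ℝ := det u x * det u y * (det v x * det v y)

/-- The linear form on the half plane that vanishes at the boundary point `u.1 / u.2`. -/
def linForm (u : ℝ × ℝ) (w : ℂ) : ℂ := w * u.2 - u.1

/-- The Möbius transformation of the upper half plane that maps `u` to `0` and `v` to `∞`; the
factor `det u v` makes it orientation preserving. -/
def moebius (u v : ℝ × ℝ) (w : ℂ) : ℂ := det u v * (linForm u w / linForm v w)

/-- Convergence in the complex projective line to the boundary point with the homogeneous
coordinates `u`. -/
def TendstoBoundary {α : Type*} (f : α → ℂ) (l : Filter α) (u : ℝ × ℝ) : Prop :=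
  ∃ c : α → ℂ, (∀ a, c a ≠ 0) ∧ Tendsto (fun a => c a * f a) l (𝓝 u.1) ∧ Tendsto c l (𝓝 u.2)

section Projective

variable {u v x y : ℝ × ℝ} {w z : ℂ} {α : Type*} {f : α → ℂ} {l : Filter α}

theorem det_swap (u v : ℝ × ℝ) : det u v = -det v u := by unfold det; ring

theorem det_self (u : ℝ × ℝ) : det u u = 0 := by unfold det; ring

theorem ne_zero_right_of_det_ne_zero (h : det u v ≠ 0) : v ≠ 0 := by
  rintro rfl; simp [det] at h

theorem det_ne_zero_of_crossing_neg (h : crossing u v x y < 0) :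
    det u x ≠ 0 ∧ det u y ≠ 0 ∧ det v x ≠ 0 ∧ det v y ≠ 0 := by
  have h' := h.ne
  simp only [crossing, ne_eq, mul_eq_zero, not_or] at h'
  tauto

theorem linForm_ne_zero (hu : u ≠ 0) (hw : w.im ≠ 0) : linForm u w ≠ 0 := by
  intro h
  have h2 : u.2 = 0 := by simpa [linForm, hw] using congrArg Complex.im h
  have h1 : u.1 = 0 := by simpa [linForm, h2] using congrArg Complex.re h
  exact hu (Prod.ext h1 h2)

theorem moebius_im_pos (h : det u v ≠ 0) (hw : 0 < w.im) : 0 < (moebius u v w).im := by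
  have him : (moebius u v w).im = det u v ^ 2 * w.im / Complex.normSq (linForm v w) := by
    rw [moebius, Complex.im_ofReal_mul, Complex.div_im, det]
    simp only [linForm, Complex.sub_im, Complex.sub_re, Complex.mul_im, Complex.mul_re,
      Complex.ofReal_im, Complex.ofReal_re]
    ring
  have hv := Complex.normSq_pos.2 (linForm_ne_zero (ne_zero_right_of_det_ne_zero h) hw.ne')
  rw [him]
  positivity

theorem moebius_injOn (h : det u v ≠ 0) : Set.InjOn (moebius u v) {w | 0 < w.im} := by
  intro w hw z hz hwz
  have hv := ne_zero_right_of_det_ne_zero h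
  have hwz' := mul_left_cancel₀ (Complex.ofReal_ne_zero.2 h) hwz
  rw [div_eq_div_iff (linForm_ne_zero hv (ne_of_gt hw)) (linForm_ne_zero hv (ne_of_gt hz))] at hwz'
  have hprod : (w - z) * (det u v : ℂ) = 0 := by
    simp only [linForm, det] at hwz' ⊢
    push_cast
    linear_combination hwz'
  exact sub_eq_zero.1 ((mul_eq_zero.1 hprod).resolve_right (Complex.ofReal_ne_zero.2 h))

theorem TendstoBoundary.comp {β : Type*} {g : β → α} {l' : Filter β} (h : TendstoBoundary f l u)
    (hg : Tendsto g l' l) : TendstoBoundary (fun b => f (g b)) l' u := by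
  obtain ⟨c, hc, hcf, hcl⟩ := h
  exact ⟨fun b => c (g b), fun b => hc _, hcf.comp hg, hcl.comp hg⟩

theorem TendstoBoundary.tendsto (h : TendstoBoundary f l u) (hu : u.2 ≠ 0) :
    Tendsto f l (𝓝 (u.1 / u.2 : ℝ)) := by
  obtain ⟨c, hc, hcf, hcl⟩ := h
  rw [Complex.ofReal_div]
  exact (hcf.div hcl (Complex.ofReal_ne_zero.2 hu)).congr fun a => mul_div_cancel_left₀ _ (hc a)

theorem tendsto_moebius (h : TendstoBoundary f l x) (hx : det x v ≠ 0) :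
    Tendsto (fun a => moebius u v (f a)) l (𝓝 (det u v * (det x u / det x v) : ℝ)) := by
  obtain ⟨c, hc, hcf, hcl⟩ := h
  have hlin : ∀ u : ℝ × ℝ, Tendsto (fun a => c a * linForm u (f a)) l (𝓝 (det x u : ℝ)) := by
    intro u
    have h := (hcf.mul_const (u.2 : ℂ)).sub (hcl.mul_const (u.1 : ℂ))
    simp only [det, Complex.ofReal_sub, Complex.ofReal_mul, mul_comm (u.1 : ℂ)]
    exact h.congr fun a => by rw [linForm]; ring
  rw [Complex.ofReal_mul, Complex.ofReal_div]
  exact (((hlin u).div (hlin v) (Complex.ofReal_ne_zero.2 hx)).congr fun a =>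
    mul_div_mul_left _ _ (hc a)).const_mul _

theorem exists_eq_of_crossing_neg {γ δ : ℝ → ℂ} (h : crossing u v x y < 0) (huv : det u v ≠ 0)
    (hγ : Continuous γ) (hδ : Continuous δ) (hγi : ∀ t, 0 < (γ t).im) (hδi : ∀ t, 0 < (δ t).im)
    (hγu : TendstoBoundary γ atBot u) (hγv : TendstoBoundary γ atTop v)
    (hδx : TendstoBoundary δ atBot x) (hδy : TendstoBoundary δ atTop y) :
    ∃ s t, γ s = δ t := by
  have hv := ne_zero_right_of_det_ne_zero huv
  have hvu : det v u ≠ 0 := by rwa [det_swap, neg_ne_zero]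
  have hxv : det x v ≠ 0 := by
    rw [det_swap, neg_ne_zero]; exact (det_ne_zero_of_crossing_neg h).2.2.1
  have hyv : det y v ≠ 0 := by
    rw [det_swap, neg_ne_zero]; exact (det_ne_zero_of_crossing_neg h).2.2.2
  have hcont : ∀ γ : ℝ → ℂ, Continuous γ → (∀ t, 0 < (γ t).im) →
      Continuous fun t => moebius u v (γ t) := fun γ hγ hγi =>
    continuous_const.mul (Continuous.div (by unfold linForm; fun_prop) (by unfold linForm; fun_prop)
      fun t => linForm_ne_zero hv (hγi t).ne')
  have hinv : Tendsto (fun t => (moebius u v (γ t))⁻¹) atTop (𝓝 0) := by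
    have h := (tendsto_moebius (u := v) hγv hvu).const_mul (-((det u v : ℂ) ^ 2)⁻¹)
    rw [det_self, zero_div, mul_zero, Complex.ofReal_zero, mul_zero] at h
    refine h.congr fun t => ?_
    have := Complex.ofReal_ne_zero.2 huv
    rw [moebius, moebius, det_swap v u, mul_inv, inv_div]
    push_cast
    field_simp
  have hneg : det u v * (det x u / det x v) * (det u v * (det y u / det y v)) < 0 := by
    have : det u v * (det x u / det x v) * (det u v * (det y u / det y v)) =
        crossing u v x y * (det u v / (det x v * det y v)) ^ 2 := by
      rw [crossing, det_swap u x, det_swap u y, det_swap v x, det_swap v y]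
      field_simp
    rw [this]
    exact mul_neg_of_neg_of_pos h (by positivity)
  obtain ⟨s, t, hst⟩ := exists_eq_of_crossing_halfPlane (hcont γ hγ hγi) (hcont δ hδ hδi)
    (fun t => moebius_im_pos huv (hγi t)) (fun t => moebius_im_pos huv (hδi t))
    (by simpa only [det_self, zero_div, mul_zero, Complex.ofReal_zero]
      using tendsto_moebius (u := u) hγu huv)
    hinv hneg (tendsto_moebius hδx hxv) (tendsto_moebius hδy hyv)
  exact ⟨s, t, moebius_injOn huv (hγi s) (hδi t) hst⟩

/-- The real quadratic form in `w` and `1` that vanishes on the geodesic of the upper half plane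
with the ends `u` and `v`. -/
def geodesicForm (u v : ℝ × ℝ) (w : ℂ) : ℝ := (linForm u w * star (linForm v w)).re

theorem geodesicForm_self_pos (hu : u ≠ 0) (hw : w.im ≠ 0) : 0 < geodesicForm u u w := by
  have hsq : geodesicForm u u w = Complex.normSq (linForm u w) := by
    simp [geodesicForm, Complex.normSq_apply]
  rw [hsq]
  exact Complex.normSq_pos.2 (linForm_ne_zero hu hw)

-- Obtained by expanding the linear forms of `u` and `v` in those of `x` and `y`.
theorem geodesicForm_expand (u v x y : ℝ × ℝ) (w : ℂ) :
    det x y ^ 2 * geodesicForm u v w =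
      det u y * det v y * geodesicForm x x w + det u x * det v x * geodesicForm y y w +
      (det u y * det x v + det x u * det v y) * geodesicForm x y w := by
  simp only [geodesicForm, linForm, det, Complex.mul_re, Complex.sub_re, Complex.sub_im,
    Complex.mul_im, Complex.ofReal_re, Complex.ofReal_im, Complex.star_def, Complex.conj_re,
    Complex.conj_im]
  ring

theorem det_eq_zero_of_geodesicForm_eq_zero (h : 0 ≤ crossing u v x y) (hx : x ≠ 0) (hy : y ≠ 0)
    (hw : w.im ≠ 0) (huv : geodesicForm u v w = 0) (hxy : geodesicForm x y w = 0) :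
    det u x * det v x = 0 ∧ det u y * det v y = 0 := by
  have key := geodesicForm_expand u v x y w
  rw [huv, hxy, mul_zero, mul_zero, add_zero] at key
  have hX := geodesicForm_self_pos hx hw
  have hY := geodesicForm_self_pos hy hw
  have hprod : 0 ≤ (det u x * det v x) * (det u y * det v y) := by
    rw [crossing] at h; linarith
  generalize det u x * det v x = p at key hprod ⊢
  generalize det u y * det v y = q at key hprod ⊢
  have hq : q ^ 2 * geodesicForm x x w = -(p * q * geodesicForm y y w) := by
    linear_combination -q * key
  have hq0 : q = 0 := by
    have hle : q ^ 2 * geodesicForm x x w ≤ 0 := by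
      rw [hq]; exact neg_nonpos.2 (mul_nonneg hprod hY.le)
    exact pow_eq_zero_iff two_ne_zero |>.1
      (le_antisymm (nonpos_of_mul_nonpos_left hle hX) (sq_nonneg _))
  rw [hq0, zero_mul, zero_add] at key
  exact ⟨(mul_eq_zero.1 key.symm).resolve_right hY.ne', hq0⟩

/-- The geodesic of the upper half plane from `u` to `v`. -/
def geodesic (u v : ℝ × ℝ) (t : ℝ) : ℂ :=
  (u.1 - Real.sign (det u v) * Real.exp t * v.1 * Complex.I) /
    (u.2 - Real.sign (det u v) * Real.exp t * v.2 * Complex.I)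

theorem geodesic_den_ne_zero (h : det u v ≠ 0) (t : ℝ) :
    (u.2 - Real.sign (det u v) * Real.exp t * v.2 * Complex.I : ℂ) ≠ 0 := by
  intro h0
  have hu : u.2 = 0 := by simpa [-Complex.ofReal_exp] using congrArg Complex.re h0
  have hv : v.2 = 0 := by
    simpa [-Complex.ofReal_exp, Real.sign_eq_zero_iff, h] using congrArg Complex.im h0
  exact h (by rw [det, hu, hv]; ring)

theorem geodesic_im_pos (h : det u v ≠ 0) (t : ℝ) : 0 < (geodesic u v t).im := by
  have hden := Complex.normSq_pos.2 (geodesic_den_ne_zero h t)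
  have him : (geodesic u v t).im = Real.exp t * (Real.sign (det u v) * det u v) /
      Complex.normSq (u.2 - Real.sign (det u v) * Real.exp t * v.2 * Complex.I : ℂ) := by
    rw [geodesic, Complex.div_im, ← sub_div]
    simp only [Complex.sub_im, Complex.sub_re, Complex.mul_im, Complex.mul_re, Complex.ofReal_im,
      Complex.ofReal_re, Complex.I_re, Complex.I_im]
    congr 1
    rw [det]
    ring
  rw [him]
  exact div_pos (mul_pos (Real.exp_pos _) (Real.sign_mul_pos_of_ne_zero _ h)) hden

theorem linForm_geodesic (h : det u v ≠ 0) (t : ℝ) :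
    linForm u (geodesic u v t) =
      Real.sign (det u v) * Real.exp t * Complex.I * linForm v (geodesic u v t) := by
  have hw : geodesic u v t * (u.2 - Real.sign (det u v) * Real.exp t * v.2 * Complex.I) =
      u.1 - Real.sign (det u v) * Real.exp t * v.1 * Complex.I :=
    div_mul_cancel₀ _ (geodesic_den_ne_zero h t)
  rw [linForm, linForm]
  linear_combination hw

theorem geodesicForm_geodesic (h : det u v ≠ 0) (t : ℝ) :
    geodesicForm u v (geodesic u v t) = 0 := by
  rw [geodesicForm, linForm_geodesic h, mul_assoc, Complex.star_def, Complex.mul_conj,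
    ← Complex.ofReal_mul]
  simp

theorem geodesic_injective (h : det u v ≠ 0) : Function.Injective (geodesic u v) := by
  intro s t hst
  have hs := linForm_geodesic h s
  rw [hst, linForm_geodesic h t] at hs
  have hv := linForm_ne_zero (ne_zero_right_of_det_ne_zero h) (geodesic_im_pos h t).ne'
  have hσ : (Real.sign (det u v) : ℂ) ≠ 0 := by
    exact_mod_cast mt Real.sign_eq_zero_iff.1 h
  have hexp : (Real.exp t : ℂ) = Real.exp s :=
    mul_left_cancel₀ hσ (mul_right_cancel₀ Complex.I_ne_zero (mul_right_cancel₀ hv hs))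
  exact (Real.exp_injective (by exact_mod_cast hexp)).symm

theorem continuous_geodesic (h : det u v ≠ 0) : Continuous (geodesic u v) :=
  Continuous.div (by fun_prop) (by fun_prop) (geodesic_den_ne_zero h)

theorem geodesic_neg (h : det u v ≠ 0) (t : ℝ) : geodesic v u (-t) = geodesic u v t := by
  have hσ : (Real.sign (det u v) : ℂ) ^ 2 = 1 := by
    rcases Real.sign_apply_eq_of_ne_zero _ h with h | h <;> rw [h] <;> norm_num
  have ht : (Real.exp (-t) : ℂ) * Real.exp t = 1 := by
    rw [← Complex.ofReal_mul, ← Real.exp_add, neg_add_cancel, Real.exp_zero, Complex.ofReal_one]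
  have h' : det v u ≠ 0 := by rwa [det_swap, neg_ne_zero]
  rw [geodesic, geodesic, div_eq_div_iff (geodesic_den_ne_zero h' _) (geodesic_den_ne_zero h _),
    det_swap v u, Real.sign_neg]
  push_cast [-Complex.ofReal_exp]
  generalize (Real.sign (det u v) : ℂ) = σ at hσ
  generalize (Real.exp (-t) : ℂ) = a, (Real.exp t : ℂ) = b at ht
  linear_combination (v.1 * u.2 - u.1 * v.2 : ℂ) * (a * b * σ ^ 2 * Complex.I_sq - a * b * hσ - ht)

theorem tendsto_ofReal_exp_atBot : Tendsto (fun t : ℝ => (Real.exp t : ℂ)) atBot (𝓝 0) := by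
  exact_mod_cast (Complex.continuous_ofReal.tendsto _).comp Real.tendsto_exp_atBot

theorem tendstoBoundary_geodesic (h : det u v ≠ 0) : TendstoBoundary (geodesic u v) atBot u := by
  have hlim : ∀ a b : ℝ, Tendsto (fun t : ℝ =>
      (a - Real.sign (det u v) * Real.exp t * b * Complex.I : ℂ)) atBot (𝓝 a) := fun a b => by
    simpa only [mul_zero, zero_mul, sub_zero] using tendsto_const_nhds.sub
      (((tendsto_ofReal_exp_atBot.const_mul (Real.sign (det u v) : ℂ)).mul_const
        (b : ℂ)).mul_const Complex.I)
  exact ⟨_, geodesic_den_ne_zero h,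
    (hlim u.1 v.1).congr fun t => (mul_div_cancel₀ _ (geodesic_den_ne_zero h t)).symm, hlim u.2 v.2⟩

end Projective

/-! ## Vertices of the strip and geodesics between them -/

namespace Vertex

/-- Homogeneous coordinates of the boundary point of the half plane that corresponds to a vertex. -/
def vec (n m : ℕ) : Vertex → ℝ × ℝ
  | lower k => (Real.exp (Real.pi * (k * (if m = 0 then 1 else (m : ℝ)))), 1)
  | upper k => (-Real.exp (Real.pi * (k * n)), 1)
  | posInf => (1, 0)
  | negInf => (0, 1)

/-- The order in which the vertices occur on the boundary of the strip, traversed clockwise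
from `∞`. -/
def Before : Vertex → Vertex → Prop
  | posInf, posInf => False
  | posInf, _ => True
  | lower _, posInf => False
  | lower k, lower l => l < k
  | lower _, _ => True
  | negInf, upper _ => True
  | negInf, _ => False
  | upper k, upper l => k < l
  | upper _, _ => False

/-- `x` occurs between `u` and `v`, in either order, on the boundary traversed from `∞`. -/
def Between (u v x : Vertex) : Prop := u.Before x ∧ x.Before v ∨ v.Before x ∧ x.Before u

/-- `x` occurs before or after both of `u` and `v` on the boundary traversed from `∞`. -/
def Outside (u v x : Vertex) : Prop := u.Before x ∧ v.Before x ∨ x.Before u ∧ x.Before v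

/-- `x` and `y` lie on different sides of the curves from `u` to `v`. -/
def Separates (u v x y : Vertex) : Prop :=
  u.Between v x ∧ u.Outside v y ∨ u.Between v y ∧ u.Outside v x

variable {n m : ℕ} {u v x y : Vertex}

theorem det_vec_pos_iff (hn : 0 < n) : 0 < det (u.vec n m) (v.vec n m) ↔ u.Before v := by
  have hm : (0 : ℝ) < if m = 0 then 1 else (m : ℝ) := by
    split_ifs with h
    · exact one_pos
    · exact_mod_cast Nat.pos_of_ne_zero h
  have hn' : (0 : ℝ) < n := by exact_mod_cast hn
  have hexp : ∀ a b : ℝ, ¬ Real.exp a < -Real.exp b := fun a b =>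
    not_lt.2 ((neg_lt_zero.2 (Real.exp_pos b)).trans (Real.exp_pos a)).le
  have hexp' : ∀ a b : ℝ, 0 < Real.exp a + Real.exp b := fun a b =>
    add_pos (Real.exp_pos a) (Real.exp_pos b)
  unfold vec
  generalize (if m = 0 then 1 else (m : ℝ)) = c at hm
  cases u <;> cases v <;>
    simp [Before, det, hm, hn', Real.pi_pos, Real.exp_pos, hexp, hexp', (Real.exp_pos _).le]

theorem vec_ne_zero : u.vec n m ≠ 0 := by cases u <;> simp [vec, Prod.ext_iff]

theorem before_trichotomy (u v : Vertex) : u.Before v ∨ u = v ∨ v.Before u := by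
  cases u <;> cases v <;> simp only [Before, lower.injEq, upper.injEq, true_or, or_true] <;> omega

theorem det_vec_eq_zero_iff (hn : 0 < n) : det (u.vec n m) (v.vec n m) = 0 ↔ u = v := by
  refine ⟨fun h => ?_, fun h => by rw [h, det_self]⟩
  have h' : det (v.vec n m) (u.vec n m) = 0 := by rw [det_swap, h, neg_zero]
  simpa [← det_vec_pos_iff (m := m) hn, h, h'] using before_trichotomy u v

theorem crossing_vec_neg_iff (hn : 0 < n) :
    crossing (u.vec n m) (v.vec n m) (x.vec n m) (y.vec n m) < 0 ↔ Separates u v x y := by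
  have hneg : ∀ {u v : Vertex}, det (u.vec n m) (v.vec n m) < 0 ↔ v.Before u := fun {u v} => by
    rw [det_swap, neg_lt_zero, det_vec_pos_iff hn]
  have hcross : crossing (u.vec n m) (v.vec n m) (x.vec n m) (y.vec n m) =
      det (u.vec n m) (x.vec n m) * det (v.vec n m) (x.vec n m) *
        (det (u.vec n m) (y.vec n m) * det (v.vec n m) (y.vec n m)) := by
    rw [crossing]; ring
  simp only [hcross, mul_neg_iff, mul_pos_iff, det_vec_pos_iff hn, hneg, Separates, Between,
    Outside]
  tauto

theorem tendstoBoundary_toHalfPlane (v : Vertex) :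
    TendstoBoundary toHalfPlane (v.toFilter n m) (v.vec n m) := by
  have hnorm : ∀ p, ‖toHalfPlane p‖ = Real.exp (Real.pi * p.1) := fun p => by
    rw [toHalfPlane, Complex.norm_exp]; simp
  have hπ := Real.pi_pos
  have hone : ∀ {l : Filter (ℝ × ℝ)} {x : ℝ}, Tendsto toHalfPlane l (𝓝 x) →
      TendstoBoundary toHalfPlane l (x, 1) := fun h =>
    ⟨fun _ => 1, fun _ => one_ne_zero, by simpa using h, by simpa using tendsto_const_nhds⟩
  cases v with
  | lower k =>
    refine hone (continuous_toHalfPlane.tendsto' _ _ ?_)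
    by_cases hm : m = 0 <;> simp [toHalfPlane, hm]
  | upper k =>
    refine hone (continuous_toHalfPlane.tendsto' _ _ ?_)
    simp [toHalfPlane, mul_add, Complex.exp_add]
  | negInf =>
    refine hone ?_
    rw [Complex.ofReal_zero, tendsto_zero_iff_norm_tendsto_zero]
    simp only [hnorm]
    exact Real.tendsto_exp_atBot.comp ((tendsto_const_mul_atBot_of_pos hπ).2 tendsto_fst)
  | posInf =>
    have hne : ∀ p, toHalfPlane p ≠ 0 := fun p => Complex.exp_ne_zero _
    refine ⟨fun p => (toHalfPlane p)⁻¹, fun p => inv_ne_zero (hne p), ?_, ?_⟩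
    · simpa [hne, vec] using tendsto_const_nhds
    · rw [vec, Complex.ofReal_zero, tendsto_zero_iff_norm_tendsto_zero]
      simp only [norm_inv, hnorm]
      exact tendsto_inv_atTop_zero.comp
        (Real.tendsto_exp_atTop.comp ((tendsto_const_mul_atTop_of_pos hπ).2 tendsto_fst))

theorem shift_injective (n m : ℕ) (j : ℤ) : Function.Injective (shift n m j) := fun v w h => by
  rwa [eq_shift_iff, shift_shift, add_neg_cancel, shift_zero, eq_comm] at h

end Vertex

section StripGeodesic

variable {n m : ℕ} {u v x y : Vertex} {α : Type*} {l : Filter α} {f : α → ℂ}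

theorem exists_eq_of_separates (hn : 0 < n) {γ δ : ℝ → ℝ × ℝ} (h : u.Separates v x y)
    (huv : u ≠ v) (hγ : Continuous γ) (hδ : Continuous δ)
    (hγs : ∀ t, γ t ∈ openStrip) (hδs : ∀ t, δ t ∈ openStrip)
    (hγu : Tendsto γ atBot (u.toFilter n m)) (hγv : Tendsto γ atTop (v.toFilter n m))
    (hδx : Tendsto δ atBot (x.toFilter n m)) (hδy : Tendsto δ atTop (y.toFilter n m)) :
    ∃ s t, γ s = δ t := by
  obtain ⟨s, t, hst⟩ := exists_eq_of_crossing_neg ((Vertex.crossing_vec_neg_iff (m := m) hn).2 h)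
    (mt (Vertex.det_vec_eq_zero_iff hn).1 huv) (continuous_toHalfPlane.comp hγ)
    (continuous_toHalfPlane.comp hδ) (fun t => toHalfPlane_im_pos (hγs t))
    (fun t => toHalfPlane_im_pos (hδs t)) (u.tendstoBoundary_toHalfPlane.comp hγu)
    (v.tendstoBoundary_toHalfPlane.comp hγv) (x.tendstoBoundary_toHalfPlane.comp hδx)
    (y.tendstoBoundary_toHalfPlane.comp hδy)
  refine ⟨s, t, ?_⟩
  rw [← ofHalfPlane_toHalfPlane (hγs s), ← ofHalfPlane_toHalfPlane (hδs t)]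
  exact congrArg ofHalfPlane hst

theorem tendsto_ofHalfPlane_of_exp_mul {r : α → ℝ} {c : ℝ} (hc : 0 < c)
    (hf : Tendsto (fun a => Real.exp (-r a) * f a) l (𝓝 (c * Complex.I)))
    (him : ∀ a, 0 < (f a).im) :
    Tendsto (fun a => (ofHalfPlane (f a)).1 - r a / Real.pi) l (𝓝 (Real.log c / Real.pi)) ∧
      Tendsto (fun a => (ofHalfPlane (f a)).2) l (𝓝 (1 / 2)) := by
  have hne : (c * Complex.I : ℂ) ≠ 0 :=
    mul_ne_zero (Complex.ofReal_ne_zero.2 hc.ne') Complex.I_ne_zero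
  have h := tendsto_ofHalfPlane hne hf fun a => by
    rw [Complex.im_ofReal_mul]; exact mul_pos (Real.exp_pos _) (him a)
  rw [ofHalfPlane_ofReal_mul_I hc, nhds_prod_eq, tendsto_prod_iff'] at h
  have hmul : ∀ a, ofHalfPlane (Real.exp (-r a) * f a) =
      ((ofHalfPlane (f a)).1 - r a / Real.pi, (ofHalfPlane (f a)).2) := fun a => by
    rw [ofHalfPlane_exp_mul _ fun h => (him a).ne' (by rw [h, Complex.zero_im]), neg_div,
      sub_eq_add_neg]
  simpa only [hmul] using h

theorem tendsto_ofHalfPlane_geodesic_posInf {v : ℝ × ℝ} (h : det (1, 0) v ≠ 0) :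
    Tendsto (fun t => ofHalfPlane (geodesic (1, 0) v t)) atBot (atTop ×ˢ 𝓝 (1 / 2)) := by
  have hc := inv_pos.2 (Real.sign_mul_pos_of_ne_zero _ h)
  have him := geodesic_im_pos h
  have hdet : det (1, 0) v = v.2 := by simp [det]
  unfold geodesic at him ⊢
  rw [hdet] at hc him ⊢
  generalize Real.sign v.2 = σ at hc him ⊢
  have hlim : Tendsto (fun t : ℝ => (((σ * v.2)⁻¹ : ℝ) * Complex.I) *
      (1 - σ * Real.exp t * v.1 * Complex.I)) atBot (𝓝 (((σ * v.2)⁻¹ : ℝ) * Complex.I)) := by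
    simpa using (((((tendsto_ofReal_exp_atBot.const_mul (σ : ℂ)).mul_const (v.1 : ℂ)).mul_const
      Complex.I).const_sub 1).const_mul (((σ * v.2)⁻¹ : ℝ) * Complex.I))
  have hexp : ∀ t : ℝ, (((σ * v.2)⁻¹ : ℝ) * Complex.I) * (1 - σ * Real.exp t * v.1 * Complex.I) =
      Real.exp (- -t) * (((1 : ℝ) - σ * Real.exp t * v.1 * Complex.I) /
        ((0 : ℝ) - σ * Real.exp t * v.2 * Complex.I)) := fun t => by
    have hσ : (σ : ℂ) * v.2 ≠ 0 := by exact_mod_cast (inv_pos.1 hc).ne'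
    obtain ⟨hσ₁, hσ₂⟩ := mul_ne_zero_iff.1 hσ
    have ht : (Real.exp t : ℂ) ≠ 0 := by exact_mod_cast (Real.exp_pos t).ne'
    have hden : (0 - σ * Real.exp t * v.2 * Complex.I : ℂ) =
        -(σ * v.2 * Complex.I * Real.exp t) := by ring
    rw [neg_neg]
    push_cast [-Complex.ofReal_exp]
    rw [hden, ← mul_div_assoc, eq_div_iff (neg_ne_zero.2
      (mul_ne_zero (mul_ne_zero hσ Complex.I_ne_zero) ht))]
    field_simp
    linear_combination (-(1 - σ * Real.exp t * v.1 * Complex.I) : ℂ) * Complex.I_sq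
  obtain ⟨h1, h2⟩ := tendsto_ofHalfPlane_of_exp_mul (r := fun t => -t) hc (hlim.congr hexp) him
  exact ((h1.add_atTop (tendsto_neg_atBot_atTop.atTop_div_const Real.pi_pos)).congr
    fun t => sub_add_cancel _ _).prodMk h2

theorem tendsto_ofHalfPlane_geodesic_negInf {v : ℝ × ℝ} (h : det (0, 1) v ≠ 0) :
    Tendsto (fun t => ofHalfPlane (geodesic (0, 1) v t)) atBot (atBot ×ˢ 𝓝 (1 / 2)) := by
  have hc := Real.sign_mul_pos_of_ne_zero _ h
  have him := geodesic_im_pos h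
  have hdet : det (0, 1) v = -v.1 := by simp [det]
  unfold geodesic at him ⊢
  rw [hdet] at hc him ⊢
  generalize Real.sign (-v.1) = σ at hc him ⊢
  have hlim : Tendsto (fun t : ℝ => ((σ * -v.1 : ℝ) * Complex.I) /
      (1 - σ * Real.exp t * v.2 * Complex.I)) atBot (𝓝 ((σ * -v.1 : ℝ) * Complex.I)) := by
    have hden := (((tendsto_ofReal_exp_atBot.const_mul (σ : ℂ)).mul_const
      (v.2 : ℂ)).mul_const Complex.I).const_sub 1
    simp only [mul_zero, zero_mul, sub_zero] at hden
    have h := (tendsto_const_nhds (x := ((σ * -v.1 : ℝ) * Complex.I : ℂ))).div hden one_ne_zero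
    rwa [div_one] at h
  have hexp : ∀ t : ℝ, ((σ * -v.1 : ℝ) * Complex.I) / (1 - σ * Real.exp t * v.2 * Complex.I) =
      Real.exp (-t) * (((0 : ℝ) - σ * Real.exp t * v.1 * Complex.I) /
        ((1 : ℝ) - σ * Real.exp t * v.2 * Complex.I)) := fun t => by
    have ht : (Real.exp (-t) : ℂ) * Real.exp t = 1 := by
      rw [← Complex.ofReal_mul, ← Real.exp_add, neg_add_cancel, Real.exp_zero, Complex.ofReal_one]
    push_cast [-Complex.ofReal_exp]
    rw [zero_sub, ← mul_div_assoc]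
    congr 1
    linear_combination (σ * v.1 * Complex.I : ℂ) * ht
  obtain ⟨h1, h2⟩ := tendsto_ofHalfPlane_of_exp_mul (r := fun t => t) hc (hlim.congr hexp) him
  exact ((h1.add_atBot (tendsto_id.atBot_div_const Real.pi_pos)).congr
    fun t => sub_add_cancel _ _).prodMk h2

/-- The geodesic of the strip from `u` to `v`. -/
def stripGeodesic (n m : ℕ) (u v : Vertex) (t : ℝ) : ℝ × ℝ :=
  ofHalfPlane (geodesic (u.vec n m) (v.vec n m) t)

theorem toHalfPlane_stripGeodesic (hn : 0 < n) (huv : u ≠ v) (t : ℝ) :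
    toHalfPlane (stripGeodesic n m u v t) = geodesic (u.vec n m) (v.vec n m) t :=
  toHalfPlane_ofHalfPlane fun h =>
    (geodesic_im_pos (mt (Vertex.det_vec_eq_zero_iff hn).1 huv) t).ne' (by rw [h, Complex.zero_im])

theorem stripGeodesic_mem_openStrip (hn : 0 < n) (huv : u ≠ v) (t : ℝ) :
    stripGeodesic n m u v t ∈ openStrip :=
  ofHalfPlane_mem_openStrip (geodesic_im_pos (mt (Vertex.det_vec_eq_zero_iff hn).1 huv) t)

theorem continuous_stripGeodesic (hn : 0 < n) (huv : u ≠ v) :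
    Continuous (stripGeodesic n m u v) :=
  have hdet := mt (Vertex.det_vec_eq_zero_iff hn).1 huv
  continuous_ofHalfPlane_comp (continuous_geodesic hdet) (geodesic_im_pos hdet)

theorem stripGeodesic_injective (hn : 0 < n) (huv : u ≠ v) :
    Function.Injective (stripGeodesic n m u v) := fun s t h =>
  geodesic_injective (mt (Vertex.det_vec_eq_zero_iff hn).1 huv) (by
    rw [← toHalfPlane_stripGeodesic hn huv, h, toHalfPlane_stripGeodesic hn huv])

theorem tendsto_stripGeodesic_atBot (hn : 0 < n) (huv : u ≠ v) :
    Tendsto (stripGeodesic n m u v) atBot (u.toFilter n m) := by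
  have hdet := mt (Vertex.det_vec_eq_zero_iff (m := m) hn).1 huv
  have hfin : ∀ x : ℝ, u.vec n m = (x, 1) → x ≠ 0 →
      Tendsto (stripGeodesic n m u v) atBot (𝓝 (ofHalfPlane x)) := fun x hx hx0 => by
    refine tendsto_ofHalfPlane (Complex.ofReal_ne_zero.2 hx0) ?_ (geodesic_im_pos hdet)
    simpa [hx] using (tendstoBoundary_geodesic hdet).tendsto (by simp [hx])
  cases u with
  | lower k =>
    have h := hfin _ rfl (Real.exp_pos _).ne'
    rwa [ofHalfPlane_ofReal_pos (Real.exp_pos _), Real.log_exp,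
      mul_div_cancel_left₀ _ Real.pi_ne_zero] at h
  | upper k =>
    have h := hfin _ rfl (neg_lt_zero.2 (Real.exp_pos _)).ne
    rwa [ofHalfPlane_ofReal_neg (neg_lt_zero.2 (Real.exp_pos _)), neg_neg, Real.log_exp,
      mul_div_cancel_left₀ _ Real.pi_ne_zero] at h
  | posInf => exact tendsto_ofHalfPlane_geodesic_posInf hdet
  | negInf => exact tendsto_ofHalfPlane_geodesic_negInf hdet

theorem tendsto_stripGeodesic_atTop (hn : 0 < n) (huv : u ≠ v) :
    Tendsto (stripGeodesic n m u v) atTop (v.toFilter n m) := by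
  have hdet := mt (Vertex.det_vec_eq_zero_iff (m := m) hn).1 huv
  exact ((tendsto_stripGeodesic_atBot hn huv.symm).comp tendsto_neg_atTop_atBot).congr fun t =>
    congrArg ofHalfPlane (geodesic_neg hdet t)

theorem toHalfPlane_deck (n m : ℕ) (j : ℤ) (p : ℝ × ℝ) :
    toHalfPlane (deck n m j p) = Real.exp (Real.pi * (j * period n m)) * toHalfPlane p := by
  rw [toHalfPlane, toHalfPlane, deck, Complex.ofReal_exp, ← Complex.exp_add]
  push_cast
  ring_nf

theorem exists_vec_shift_eq (hu : u.IsMarked m ∨ u.IsInfinite) (j : ℤ) :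
    ∃ c : ℝ, (u.shift n m j).vec n m =
      (c * Real.exp (Real.pi * (j * period n m)) * (u.vec n m).1, c * (u.vec n m).2) := by
  cases u with
  | posInf => exact ⟨(Real.exp (Real.pi * (j * period n m)))⁻¹, by simp [Vertex.shift, Vertex.vec]⟩
  | negInf => exact ⟨1, by simp [Vertex.shift, Vertex.vec]⟩
  | lower k =>
    refine ⟨1, ?_⟩
    simp only [Vertex.shift, Vertex.vec, one_mul, ← Real.exp_add]
    by_cases hm : m = 0 <;> simp [period, hm] <;> ring
  | upper k =>
    have hm : m ≠ 0 := by simpa only [Vertex.IsMarked, Vertex.IsInfinite, or_false] using hu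
    refine ⟨1, ?_⟩
    simp only [Vertex.shift, Vertex.vec, one_mul, mul_neg, ← Real.exp_add, period, if_neg hm]
    push_cast
    ring_nf

theorem geodesicForm_shift (hu : u.IsMarked m ∨ u.IsInfinite) (hv : v.IsMarked m ∨ v.IsInfinite)
    (j : ℤ) {p : ℝ × ℝ} (h : geodesicForm (u.vec n m) (v.vec n m) (toHalfPlane p) = 0) :
    geodesicForm ((u.shift n m j).vec n m) ((v.shift n m j).vec n m)
      (toHalfPlane (deck n m j p)) = 0 := by
  obtain ⟨c, hc⟩ := exists_vec_shift_eq (n := n) hu j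
  obtain ⟨d, hd⟩ := exists_vec_shift_eq (n := n) hv j
  rw [toHalfPlane_deck]
  generalize Real.exp (Real.pi * (j * period n m)) = E at hc hd
  have hlin : ∀ (c : ℝ) (u : ℝ × ℝ) (w : ℂ),
      linForm (c * E * u.1, c * u.2) (E * w) = (c * E : ℝ) * linForm u w := fun c u w => by
    simp only [linForm]; push_cast; ring
  have hscale : ∀ (a b : ℝ) (w z : ℂ), (a * w * star (b * z)).re = a * b * (w * star z).re :=
    fun a b w z => by
      rw [← Complex.re_ofReal_mul]
      congr 1
      simp only [star_mul', Complex.star_def, Complex.conj_ofReal, Complex.ofReal_mul]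
      ring
  rw [geodesicForm, hc, hd, hlin, hlin, hscale]
  exact mul_eq_zero_of_right _ h

theorem ends_eq_of_geodesicForm_eq_zero (hn : 0 < n) (hxy : x ≠ y) (h : ¬ u.Separates v x y)
    {p : ℝ × ℝ} (hp : p ∈ openStrip)
    (huv : geodesicForm (u.vec n m) (v.vec n m) (toHalfPlane p) = 0)
    (hxy' : geodesicForm (x.vec n m) (y.vec n m) (toHalfPlane p) = 0) :
    u = x ∧ v = y ∨ u = y ∧ v = x := by
  rw [← Vertex.crossing_vec_neg_iff (m := m) hn, not_lt] at h
  have h := det_eq_zero_of_geodesicForm_eq_zero h Vertex.vec_ne_zero Vertex.vec_ne_zero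
    (toHalfPlane_im_pos hp).ne' huv hxy'
  simp only [mul_eq_zero, Vertex.det_vec_eq_zero_iff hn] at h
  grind

theorem cover_eq_iff {p q : ℝ × ℝ} :
    cover n m p = cover n m q ↔ ∃ j, p = deck n m j q := by
  rw [cover, cover, Prod.mk.injEq, ← sub_eq_zero, ← AddCircle.coe_sub, AddCircle.coe_eq_zero_iff,
    ← exists_and_right]
  refine exists_congr fun j => ?_
  rw [deck, Prod.ext_iff, zsmul_eq_mul]
  exact and_congr_left' ⟨fun h => by linarith, fun h => by linarith⟩

theorem exists_shift_eq_of_cover_stripGeodesic_eq (hn : 0 < n) (huv : u ≠ v) (hxy : x ≠ y)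
    (hx : x.IsMarked m ∨ x.IsInfinite) (hy : y.IsMarked m ∨ y.IsInfinite)
    (h : ∀ j, ¬ u.Separates v (x.shift n m j) (y.shift n m j)) {s t : ℝ}
    (hst : cover n m (stripGeodesic n m u v s) = cover n m (stripGeodesic n m x y t)) :
    ∃ j, stripGeodesic n m u v s = deck n m j (stripGeodesic n m x y t) ∧
      (u = x.shift n m j ∧ v = y.shift n m j ∨ u = y.shift n m j ∧ v = x.shift n m j) := by
  have hform : ∀ {u v : Vertex}, u ≠ v → ∀ t,
      geodesicForm (u.vec n m) (v.vec n m) (toHalfPlane (stripGeodesic n m u v t)) = 0 :=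
    fun huv t => by
      rw [toHalfPlane_stripGeodesic hn huv]
      exact geodesicForm_geodesic (mt (Vertex.det_vec_eq_zero_iff hn).1 huv) t
  obtain ⟨j, hj⟩ := cover_eq_iff.1 hst
  refine ⟨j, hj, ends_eq_of_geodesicForm_eq_zero hn (fun h => hxy ?_) (h j)
    (stripGeodesic_mem_openStrip hn huv s) (hform huv s) ?_⟩
  · exact Vertex.shift_injective n m j h
  · rw [hj]; exact geodesicForm_shift hx hy j (hform hxy t)

end StripGeodesic

/-! ## Arcs and edges -/

section Ends

variable {n m : ℕ} {j : ℤ} {u v x y : Vertex}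

theorem period_pos (hn : 0 < n) : 0 < period n m := by
  unfold period
  split_ifs with h
  · exact_mod_cast hn
  · exact_mod_cast Nat.mul_pos hn (Nat.pos_of_ne_zero h)

theorem cover_deck (j : ℤ) (p : ℝ × ℝ) : cover n m (deck n m j p) = cover n m p :=
  cover_eq_iff.2 ⟨j, rfl⟩

theorem eq_zero_of_deck_eq (hn : 0 < n) {p : ℝ × ℝ} (h : deck n m j p = p) : j = 0 := by
  have h1 : p.1 + j * period n m = p.1 := congrArg Prod.fst h
  exact_mod_cast (mul_eq_zero.1 (add_eq_left.1 h1)).resolve_right (period_pos hn).ne'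

theorem boundarySegment_comm : BoundarySegment m u v ↔ BoundarySegment m v u := by
  cases u <;> cases v <;> simp only [BoundarySegment] <;> omega

theorem boundarySegment_shift :
    BoundarySegment m (u.shift n m j) (v.shift n m j) ↔ BoundarySegment m u v := by
  cases u <;> cases v <;> simp only [BoundarySegment, Vertex.shift] <;> omega

namespace Vertex

theorem isMarked_shift : (u.shift n m j).IsMarked m ↔ u.IsMarked m := by
  cases u <;> rfl

theorem isInfinite_shift : (u.shift n m j).IsInfinite ↔ u.IsInfinite := by
  cases u <;> rfl

theorem eq_zero_of_eq_shift (hn : 0 < n) (hu : u.IsMarked m) (h : u = u.shift n m j) : j = 0 := by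
  cases u with
  | lower k =>
    have hj : j * n = 0 := by simpa only [shift, lower.injEq, left_eq_add] using h
    exact (mul_eq_zero.1 hj).resolve_right (by exact_mod_cast hn.ne')
  | upper k =>
    have hj : j * m = 0 := by simpa only [shift, upper.injEq, left_eq_add] using h
    exact (mul_eq_zero.1 hj).resolve_right (by exact_mod_cast hu)
  | posInf => exact hu.elim
  | negInf => exact hu.elim

theorem not_separates_self : ¬ u.Separates v u v := by
  cases u <;> cases v <;> simp [Separates, Between, Outside, Before]

theorem not_separates_self_swap : ¬ u.Separates v v u := by
  cases u <;> cases v <;> simp [Separates, Between, Outside, Before]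

end Vertex

/-- `u` and `v` are the ends of a curve that is not contractible or homotopic to a boundary
segment. -/
structure IsArcPair (m : ℕ) (u v : Vertex) : Prop where
  ends : (u.IsMarked m ∧ v.IsMarked m) ∨ (u.IsMarked m ∧ v.IsInfinite) ∨
    (u.IsInfinite ∧ v.IsMarked m)
  ne : u ≠ v
  not_boundary : ¬ BoundarySegment m u v

namespace IsArcPair

theorem symm (h : IsArcPair m u v) : IsArcPair m v u where
  ends := by have := h.ends; tauto
  ne := h.ne.symm
  not_boundary := mt boundarySegment_comm.1 h.not_boundary

theorem valid_left (h : IsArcPair m u v) : u.IsMarked m ∨ u.IsInfinite := by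
  have := h.ends; tauto

theorem eq_zero_of_eq_shift (hn : 0 < n) (huv : IsArcPair m u v)
    (h : u = u.shift n m j ∧ v = v.shift n m j ∨ u = v.shift n m j ∧ v = u.shift n m j) :
    j = 0 := by
  have htwice : u = u.shift n m (j + j) ∧ v = v.shift n m (j + j) := by
    rw [← Vertex.shift_shift, ← Vertex.shift_shift]
    rcases h with ⟨h1, h2⟩ | ⟨h1, h2⟩
    · exact ⟨h1.trans (congrArg _ h1), h2.trans (congrArg _ h2)⟩
    · exact ⟨h1.trans (congrArg _ h2), h2.trans (congrArg _ h1)⟩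
  have hj : j + j = 0 := by
    rcases huv.ends with h | h | h
    · exact Vertex.eq_zero_of_eq_shift hn h.1 htwice.1
    · exact Vertex.eq_zero_of_eq_shift hn h.1 htwice.1
    · exact Vertex.eq_zero_of_eq_shift hn h.2 htwice.2
  omega

end IsArcPair

end Ends

namespace Curve

variable {n m : ℕ} {u v : Vertex}

/-- The geodesic with the given ends, a simple curve of the annulus since its translates do not
cross it. -/
def ofEnds (hn : 0 < n) (huv : IsArcPair m u v)
    (h : ∀ j, ¬ u.Separates v (u.shift n m j) (v.shift n m j)) : Curve n m where
  src := u
  tgt := v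
  toFun := stripGeodesic n m u v
  continuous_toFun := continuous_stripGeodesic hn huv.ne
  mem_openStrip := stripGeodesic_mem_openStrip hn huv.ne
  tendsto_src := tendsto_stripGeodesic_atBot hn huv.ne
  tendsto_tgt := tendsto_stripGeodesic_atTop hn huv.ne
  ends := huv.ends
  not_closed := huv.ne
  not_boundary := huv.not_boundary
  simple := by
    intro s t hst
    obtain ⟨j, hj, hends⟩ := exists_shift_eq_of_cover_stripGeodesic_eq hn huv.ne huv.ne
      huv.valid_left huv.symm.valid_left h hst
    refine stripGeodesic_injective (m := m) hn huv.ne ?_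
    rw [hj, huv.eq_zero_of_eq_shift hn hends]
    simp [deck]

/-- The curve with the opposite orientation. -/
def reverse (c : Curve n m) : Curve n m where
  src := c.tgt
  tgt := c.src
  toFun t := c.toFun (-t)
  continuous_toFun := c.continuous_toFun.comp continuous_neg
  mem_openStrip t := c.mem_openStrip _
  tendsto_src := c.tendsto_tgt.comp tendsto_neg_atBot_atTop
  tendsto_tgt := c.tendsto_src.comp tendsto_neg_atTop_atBot
  ends := by have := c.ends; tauto
  not_closed := c.not_closed.symm
  not_boundary := mt boundarySegment_comm.1 c.not_boundary
  simple := c.simple.comp neg_injective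

/-- The image of a lifted curve under a deck transformation. -/
def translate (c : Curve n m) (j : ℤ) : Curve n m where
  src := c.src.shift n m j
  tgt := c.tgt.shift n m j
  toFun t := deck n m j (c.toFun t)
  continuous_toFun := (continuous_deck n m j).comp c.continuous_toFun
  mem_openStrip := c.mem_openStrip
  tendsto_src := (tendsto_deck n m j c.src_valid).comp c.tendsto_src
  tendsto_tgt := (tendsto_deck n m j c.tgt_valid).comp c.tendsto_tgt
  ends := by simpa only [Vertex.isMarked_shift, Vertex.isInfinite_shift] using c.ends
  not_closed h := c.not_closed (Vertex.shift_injective n m j h)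
  not_boundary := mt boundarySegment_shift.1 c.not_boundary
  simple := by simpa only [cover_deck] using c.simple

variable {c d : Curve n m}

theorem toArc_eq_iff : c.toArc = d.toArc ↔
    ∃ j : ℤ, c.src = d.src.shift n m j ∧ c.tgt = d.tgt.shift n m j ∨
      c.src = d.tgt.shift n m j ∧ c.tgt = d.src.shift n m j :=
  Quotient.eq.trans (c.equivalent_iff d)

theorem toArc_reverse : c.reverse.toArc = c.toArc :=
  toArc_eq_iff.2 ⟨0, Or.inr (by simp [Vertex.shift_zero, reverse])⟩

theorem toArc_translate (j : ℤ) : (c.translate j).toArc = c.toArc :=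
  toArc_eq_iff.2 ⟨j, Or.inl ⟨rfl, rfl⟩⟩

theorem exists_translate_ends_eq (h : c.toArc = d.toArc) :
    ∃ (e : Curve n m) (j : ℤ), (e = d ∨ e = d.reverse) ∧
      c.src = (e.translate j).src ∧ c.tgt = (e.translate j).tgt := by
  obtain ⟨j, h | h⟩ := toArc_eq_iff.1 h
  · exact ⟨d, j, Or.inl rfl, h.1, h.2⟩
  · exact ⟨d.reverse, j, Or.inr rfl, h.1, h.2⟩

theorem exists_toFun_eq {e : Curve n m} (h : e = d ∨ e = d.reverse) (s : ℝ) :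
    ∃ t, e.toFun s = d.toFun t := by
  rcases h with rfl | rfl
  · exact ⟨s, rfl⟩
  · exact ⟨-s, rfl⟩

theorem exists_toFun_eq_of_separates (hn : 0 < n) (h : c.src.Separates c.tgt d.src d.tgt) :
    ∃ s t, c.toFun s = d.toFun t :=
  exists_eq_of_separates hn h c.not_closed c.continuous_toFun d.continuous_toFun
    c.mem_openStrip d.mem_openStrip c.tendsto_src c.tendsto_tgt d.tendsto_src d.tendsto_tgt

theorem not_separates_of_toArc_eq (hn : 0 < n) (h : c.toArc = d.toArc) :
    ¬ c.src.Separates c.tgt d.src d.tgt := by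
  intro hsep
  obtain ⟨e, j, he, hsrc, htgt⟩ := exists_translate_ends_eq h
  rw [hsrc, htgt] at hsep
  obtain ⟨s, t, hst⟩ := exists_toFun_eq_of_separates hn hsep
  obtain ⟨s', hs'⟩ := exists_toFun_eq he s
  have hdeck : deck n m j (d.toFun s') = d.toFun t := by rw [← hs']; exact hst
  have hs't : s' = t := d.simple (by simp only [← hdeck, cover_deck])
  rw [hs't] at hdeck
  rw [eq_zero_of_deck_eq hn hdeck] at hsep
  simp only [translate, Vertex.shift_zero] at hsep
  rcases he with rfl | rfl
  · exact Vertex.not_separates_self hsep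
  · exact Vertex.not_separates_self_swap hsep

theorem not_separates_of_compatible (hn : 0 < n) (h : Compatible c.toArc d.toArc) :
    ¬ c.src.Separates c.tgt d.src d.tgt := by
  intro hsep
  obtain ⟨c', d', hc, hd, hdisj⟩ := h
  obtain ⟨e, i, he, hce⟩ := exists_translate_ends_eq hc.symm
  obtain ⟨f, j, hf, hdf⟩ := exists_translate_ends_eq hd.symm
  rw [hce.1, hce.2, hdf.1, hdf.2] at hsep
  obtain ⟨s, t, hst⟩ := exists_toFun_eq_of_separates hn hsep
  obtain ⟨s', hs'⟩ := exists_toFun_eq he s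
  obtain ⟨t', ht'⟩ := exists_toFun_eq hf t
  refine hdisj s' t' ?_
  rw [← hs', ← ht', ← cover_deck i, ← cover_deck j (f.toFun t)]
  exact congrArg (cover n m) hst

end Curve

section Edge

variable {n m : ℕ} {T : Set (Arc n m)} {u v x y : Vertex}

/-- `u` and `v` are the ends of an arc of the preimage of `T` in the strip. -/
def Edge (T : Set (Arc n m)) (u v : Vertex) : Prop :=
  ∃ c : Curve n m, c.toArc ∈ T ∧ c.src = u ∧ c.tgt = v

theorem Edge.isArcPair (h : Edge T u v) : IsArcPair m u v := by
  obtain ⟨c, -, rfl, rfl⟩ := h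
  exact ⟨c.ends, c.not_closed, c.not_boundary⟩

theorem Edge.symm (h : Edge T u v) : Edge T v u := by
  obtain ⟨c, hc, rfl, rfl⟩ := h
  exact ⟨c.reverse, by rwa [c.toArc_reverse], rfl, rfl⟩

theorem edge_comm : Edge T u v ↔ Edge T v u := ⟨Edge.symm, Edge.symm⟩

theorem Edge.shift (h : Edge T u v) (j : ℤ) : Edge T (u.shift n m j) (v.shift n m j) := by
  obtain ⟨c, hc, rfl, rfl⟩ := h
  exact ⟨c.translate j, by rwa [c.toArc_translate], rfl, rfl⟩

theorem Edge.not_separates (hn : 0 < n) (hT : T.Pairwise Compatible) (h : Edge T u v)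
    (h' : Edge T x y) : ¬ u.Separates v x y := by
  obtain ⟨c, hc, rfl, rfl⟩ := h
  obtain ⟨d, hd, rfl, rfl⟩ := h'
  by_cases hcd : c.toArc = d.toArc
  · exact Curve.not_separates_of_toArc_eq hn hcd
  · exact Curve.not_separates_of_compatible hn (hT hc hd hcd)

theorem Compatible.symm {A B : Arc n m} (h : Compatible A B) : Compatible B A := by
  obtain ⟨c, d, hc, hd, h⟩ := h
  exact ⟨d, c, hd, hc, fun s t => (h t s).symm⟩

theorem edge_of_not_outside (hn : 0 < n) (hT : IsTriangulation T) (huv : IsArcPair m u v)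
    (hself : ∀ j, ¬ u.Separates v (u.shift n m j) (v.shift n m j))
    (h : ∀ x y, Edge T x y → u.Between v x → ¬ u.Outside v y) : Edge T u v := by
  have hsep : ∀ {x y}, Edge T x y → ¬ u.Separates v x y := fun {x y} hxy =>
    not_or.2 ⟨not_and.2 (h x y hxy), not_and.2 (h y x hxy.symm)⟩
  let c := Curve.ofEnds hn huv hself
  suffices hins : (insert c.toArc T).Pairwise Compatible from
    ⟨c, hT.2 hins (Set.subset_insert _ _) (Set.mem_insert _ _), rfl, rfl⟩
  refine hT.1.insert fun B hB hne => ?_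
  suffices hcB : Compatible c.toArc B from ⟨hcB, hcB.symm⟩
  obtain ⟨b, rfl⟩ : ∃ b : Curve n m, b.toArc = B := Quotient.exists_rep B
  have hb : Edge T b.src b.tgt := ⟨b, hB, rfl, rfl⟩
  let d := Curve.ofEnds hn hb.isArcPair fun j => hb.not_separates hn hT.1 (hb.shift j)
  have hdb : d.toArc = b.toArc :=
    Curve.toArc_eq_iff.2 ⟨0, Or.inl ⟨(Vertex.shift_zero ..).symm, (Vertex.shift_zero ..).symm⟩⟩
  refine ⟨c, d, rfl, hdb, fun s t hst => hne (hdb ▸ Curve.toArc_eq_iff.2 ?_)⟩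
  obtain ⟨j, -, hj⟩ := exists_shift_eq_of_cover_stripGeodesic_eq hn huv.ne b.not_closed
    b.src_valid b.tgt_valid (fun j => hsep (hb.shift j)) hst
  exact ⟨j, hj⟩

end Edge

/-! ## Friezes from positive supersolutions -/

/-- The solution of the recursion `x (k + 2) = a (i + k) x (k + 1) - x k` with the initial values
`0`, `1`. -/
def continuant {R : Type*} [Ring R] (a : ℤ → R) (i : ℤ) : ℕ → R
  | 0 => 0
  | 1 => 1
  | k + 2 => a (i + k) * continuant a i (k + 1) - continuant a i k

theorem continuant_add_two {R : Type*} [Ring R] (a : ℤ → R) (i : ℤ) (k : ℕ) :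
    continuant a i (k + 2) = a (i + k) * continuant a i (k + 1) - continuant a i k :=
  rfl

theorem continuant_unimodular {R : Type*} [CommRing R] (a : ℤ → R) (i : ℤ) (k : ℕ) :
    continuant a i (k + 1) * continuant a (i + 1) (k + 1) -
      continuant a (i + 1) k * continuant a i (k + 2) = 1 := by
  induction k with
  | zero => simp [continuant]
  | succ k ih =>
    have hk : i + 1 + (k : ℤ) = i + ((k + 1 : ℕ) : ℤ) := by push_cast; ring
    rw [continuant_add_two a i (k + 1), continuant_add_two a (i + 1) k, hk]
    linear_combination ih

section Positive

variable {R : Type*} [CommRing R] [LinearOrder R] [IsStrictOrderedRing R] {a w : ℤ → R}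

theorem continuant_pos_and_mul_lt_mul (hw : ∀ p, 0 < w p)
    (h : ∀ p, w (p - 1) + w (p + 1) ≤ a p * w p) (i : ℤ) (k : ℕ) :
    0 < continuant a i (k + 1) ∧
      continuant a i k * w (i + k) < continuant a i (k + 1) * w (i + k - 1) := by
  induction k with
  | zero => simpa [continuant] using hw (i - 1)
  | succ k ih =>
    have hcast : i + ((k + 1 : ℕ) : ℤ) = i + k + 1 := by push_cast; ring
    rw [hcast, add_sub_cancel_right]
    have hlt : continuant a i (k + 1) * w (i + k + 1) < continuant a i (k + 2) * w (i + k) := by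
      rw [continuant_add_two]
      linear_combination ih.2 + mul_le_mul_of_nonneg_left (h (i + k)) ih.1.le
    exact ⟨pos_of_mul_pos_left ((mul_pos ih.1 (hw _)).trans hlt) (hw _).le, hlt⟩

theorem continuant_pos (hw : ∀ p, 0 < w p) (h : ∀ p, w (p - 1) + w (p + 1) ≤ a p * w p) (i : ℤ)
    (k : ℕ) : 0 < continuant a i (k + 1) :=
  (continuant_pos_and_mul_lt_mul hw h i k).1

end Positive

theorem exists_isInfiniteFrieze {a w : ℤ → ℤ} (hw : ∀ p, 0 < w p)
    (h : ∀ p, w (p - 1) + w (p + 1) ≤ a p * w p) :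
    ∃ F : ℤ → ℤ → ℤ, IsInfiniteFrieze F ∧ ∀ i, F i i = a i := by
  let F : ℤ → ℤ → ℤ := fun i j => continuant a i (j - i + 2).toNat
  have hF : ∀ {i j : ℤ} {k : ℕ}, j - i + 2 = k → F i j = continuant a i k := fun {i j k} hk => by
    simp only [F, hk, Int.toNat_natCast]
  refine ⟨F, ⟨fun i => ?_, fun i => ?_, fun i j hij => ?_, fun i j hij => ?_⟩, fun i => ?_⟩
  · exact hF (k := 0) (by push_cast; ring)
  · exact hF (k := 1) (by push_cast; ring)
  · obtain ⟨k, rfl⟩ := Int.le.dest hij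
    rw [hF (k := k + 1 + 1) (by push_cast; ring)]
    exact continuant_pos hw h i (k + 1)
  · obtain ⟨k, rfl⟩ := Int.le.dest hij
    rw [hF (k := k + 1) (by push_cast; ring), hF (k := k + 1) (by push_cast; ring),
      hF (k := k) (by ring), hF (k := k + 2) (by push_cast; ring)]
    exact continuant_unimodular a i k
  · rw [hF (k := 2) (by push_cast; ring)]
    simp [continuant]

/-! ## Systems of peripheral arcs -/

/-- A system of pairwise noncrossing arcs of bounded length between integers, given by their ends
`i < j`, that contains the segments `(i, i + 1)` and has a triangle below each of the other arcs. -/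
structure IsPeripheralSystem (N : ℤ) (J : ℤ → ℤ → Prop) : Prop where
  lt : ∀ {i j}, J i j → i < j
  le_add : ∀ {i j}, J i j → j ≤ i + N
  segment : ∀ i, J i (i + 1)
  noncrossing : ∀ {i j k l}, J i j → J k l → i < k → k < j → l ≤ j
  exists_triangle : ∀ {i j}, J i j → i + 1 < j → ∃ r, J i r ∧ J r j

/-- The arcs of a system that pass over `p`. -/
def arcsOver (J : ℤ → ℤ → Prop) (p : ℤ) : Set (ℤ × ℤ) := {e | J e.1 e.2 ∧ e.1 < p ∧ p < e.2}

/-- The arcs of a system that span a triangle together with `p`. -/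
def link (J : ℤ → ℤ → Prop) (p : ℤ) : Set (ℤ × ℤ) :=
  {e | J e.1 e.2 ∧ (J e.1 p ∨ J p e.1) ∧ (J e.2 p ∨ J p e.2)}

/-- A weight for which the middle vertex of each triangle weighs as much as the two outer ones. -/
def IsAdditive (J : ℤ → ℤ → Prop) (w : ℤ → ℤ) : Prop :=
  ∀ ⦃i p j⦄, J i p → J p j → J i j → w p = w i + w j

namespace IsPeripheralSystem

variable {N : ℤ} {J : ℤ → ℤ → Prop} {p i j : ℤ}

theorem finite_arcsOver (h : IsPeripheralSystem N J) (p : ℤ) : (arcsOver J p).Finite := by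
  refine (Set.finite_Icc ((p - N, p - N) : ℤ × ℤ) (p + N, p + N)).subset ?_
  rintro ⟨i, j⟩ ⟨hij, hi, hj⟩
  have := h.le_add hij
  simp only [Set.mem_Icc, Prod.mk_le_mk] at hi hj this ⊢
  omega

theorem finite_link (h : IsPeripheralSystem N J) (p : ℤ) : (link J p).Finite := by
  refine (Set.finite_Icc ((p - N, p - N) : ℤ × ℤ) (p + N, p + N)).subset ?_
  rintro ⟨i, j⟩ ⟨-, hi, hj⟩
  have hbound : ∀ {k}, J k p ∨ J p k → p - N ≤ k ∧ k ≤ p + N := by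
    rintro k (hk | hk) <;> have := h.lt hk <;> have := h.le_add hk <;> omega
  exact ⟨⟨(hbound hi).1, (hbound hj).1⟩, (hbound hi).2, (hbound hj).2⟩

theorem neg (h : IsPeripheralSystem N J) : IsPeripheralSystem N fun i j => J (-j) (-i) where
  lt hij := neg_lt_neg_iff.1 (h.lt hij)
  le_add hij := by have := h.le_add hij; omega
  segment i := by simpa only [neg_add', sub_add_cancel] using h.segment (-i - 1)
  noncrossing hij hkl hik hkj := by
    by_contra! hlj
    have := h.noncrossing hkl hij (neg_lt_neg hlj) (neg_lt_neg hkj)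
    omega
  exists_triangle hij hlt := by
    obtain ⟨r, hr, hr'⟩ := h.exists_triangle hij (by omega)
    exact ⟨-r, by rwa [neg_neg], by rwa [neg_neg]⟩

/-! ### The weight of a system -/

theorem exists_apex {i j : ℤ} (h : IsPeripheralSystem N J) (hij : J i j) (hi : i < p) (hj : p < j) :
    ∃ i j, J i p ∧ J p j ∧ J i j := by
  obtain ⟨r, hr, hr'⟩ := h.exists_triangle hij (by omega)
  have := h.lt hr
  have := h.lt hr'
  rcases lt_trichotomy r p with hp | rfl | hp
  · exact h.exists_apex hr' hp hj
  · exact ⟨i, j, hr, hr', hij⟩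
  · exact h.exists_apex hr hi hp
termination_by (j - i).toNat

theorem apex_unique (h : IsPeripheralSystem N J) {i' j' : ℤ} (hip : J i p) (hpj : J p j)
    (hij : J i j) (hip' : J i' p) (hpj' : J p j') (hij' : J i' j') : i = i' ∧ j = j' := by
  have hi := h.lt hip
  have hj := h.lt hpj
  have hi' := h.lt hip'
  have hj' := h.lt hpj'
  refine ⟨?_, le_antisymm (h.noncrossing hij' hpj hi' hj') (h.noncrossing hij hpj' hi hj)⟩
  rcases lt_trichotomy i i' with hlt | heq | hlt
  · exact absurd (h.noncrossing hip hij' hlt hi') hj'.not_ge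
  · exact heq
  · exact absurd (h.noncrossing hip' hij hlt hi) hj.not_ge

theorem arcsOver_left_ssubset (h : IsPeripheralSystem N J) (hip : J i p) (hpj : J p j)
    (hij : J i j) : arcsOver J i ⊂ arcsOver J p := by
  have hi := h.lt hip
  have hj := h.lt hpj
  refine (Set.ssubset_iff_of_subset ?_).2 ⟨(i, j), ⟨hij, hi, hj⟩, fun h' => h'.2.1.false⟩
  rintro ⟨k, l⟩ ⟨hkl, hk, hl⟩
  exact ⟨hkl, hk.trans hi, hj.trans_le (h.noncrossing hkl hij hk hl)⟩

theorem arcsOver_right_ssubset (h : IsPeripheralSystem N J) (hip : J i p) (hpj : J p j)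
    (hij : J i j) : arcsOver J j ⊂ arcsOver J p := by
  have hi := h.lt hip
  have hj := h.lt hpj
  refine (Set.ssubset_iff_of_subset ?_).2 ⟨(i, j), ⟨hij, hi, hj⟩, fun h' => h'.2.2.false⟩
  rintro ⟨k, l⟩ ⟨hkl, hk, hl⟩
  refine ⟨hkl, ?_, hj.trans hl⟩
  rcases lt_trichotomy k p with hp | rfl | hp
  · exact hp
  · exact absurd (h.noncrossing hij hkl hi hj) hl.not_ge
  · exact absurd (h.noncrossing hpj hkl hp hk) hl.not_ge

open Classical in
/-- The weight of an integer is `1` if no arc passes over it, and otherwise it is the sum of the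
weights of the ends of the shortest arc that passes over it. -/
def weight (h : IsPeripheralSystem N J) (p : ℤ) : ℤ :=
  if hp : ∃ e : ℤ × ℤ, J e.1 p ∧ J p e.2 ∧ J e.1 e.2 then
    weight h hp.choose.1 + weight h hp.choose.2
  else 1
termination_by (arcsOver J p).ncard
decreasing_by
  · exact Set.ncard_lt_ncard (h.arcsOver_left_ssubset hp.choose_spec.1 hp.choose_spec.2.1
      hp.choose_spec.2.2) (h.finite_arcsOver p)
  · exact Set.ncard_lt_ncard (h.arcsOver_right_ssubset hp.choose_spec.1 hp.choose_spec.2.1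
      hp.choose_spec.2.2) (h.finite_arcsOver p)

theorem isAdditive_weight (h : IsPeripheralSystem N J) : IsAdditive J h.weight := by
  intro i p j hip hpj hij
  have hp : ∃ e : ℤ × ℤ, J e.1 p ∧ J p e.2 ∧ J e.1 e.2 := ⟨(i, j), hip, hpj, hij⟩
  obtain ⟨hi, hj⟩ :=
    h.apex_unique hip hpj hij hp.choose_spec.1 hp.choose_spec.2.1 hp.choose_spec.2.2
  rw [weight, dif_pos hp, hi, hj]

theorem weight_of_arcsOver_eq_empty (h : IsPeripheralSystem N J) (hp : arcsOver J p = ∅) :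
    h.weight p = 1 := by
  rw [weight, dif_neg]
  rintro ⟨e, h1, h2, h3⟩
  exact hp.subset ⟨h3, h.lt h1, h.lt h2⟩

theorem weight_pos (h : IsPeripheralSystem N J) (p : ℤ) : 0 < h.weight p := by
  fun_induction weight h p with
  | case1 p hp ih1 ih2 => exact add_pos ih1 ih2
  | case2 => exact one_pos

/-! ### The fans of triangles at a vertex -/

theorem exists_fan_of_arc (h : IsPeripheralSystem N J) {w : ℤ → ℤ} (hw : IsAdditive J w) {l : ℤ}
    (hl : J l p) : ∃ S : Finset (ℤ × ℤ), (∀ e ∈ S, l ≤ e.1 ∧ J e.1 e.2 ∧ J e.1 p ∧ J e.2 p) ∧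
      w (p - 1) = w l + S.card * w p := by
  have hlp := h.lt hl
  rcases (Int.add_one_le_of_lt hlp).eq_or_lt with rfl | hp
  · exact ⟨∅, by simp, by simp⟩
  obtain ⟨r, hr, hr'⟩ := h.exists_triangle hl hp
  have hlr := h.lt hr
  have := h.lt hr'
  obtain ⟨S, hS, hcard⟩ := h.exists_fan_of_arc hw hr'
  have hmem : (l, r) ∉ S := fun hlS => hlr.not_ge (hS _ hlS).1
  refine ⟨insert (l, r) S, ?_, ?_⟩
  · rw [Finset.forall_mem_insert]
    exact ⟨⟨le_rfl, hr, hl, hr'⟩, fun e he => ⟨hlr.le.trans (hS e he).1, (hS e he).2⟩⟩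
  · rw [Finset.card_insert_of_notMem hmem, hcard, hw hr hr' hl]
    push_cast
    ring
termination_by (p - l).toNat

theorem exists_left_fan (h : IsPeripheralSystem N J) {w : ℤ → ℤ} (hw : IsAdditive J w) (p : ℤ) :
    ∃ (l : ℤ) (S : Finset (ℤ × ℤ)), J l p ∧ (∀ k, J k p → l ≤ k) ∧
      (∀ e ∈ S, J e.1 e.2 ∧ J e.1 p ∧ J e.2 p) ∧ w (p - 1) = w l + S.card * w p := by
  obtain ⟨l, hl, hmin⟩ := Int.exists_least_of_bdd (P := fun l => J l p)
    ⟨p - N, fun k hk => by have := h.le_add hk; omega⟩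
    ⟨p - 1, by simpa using h.segment (p - 1)⟩
  obtain ⟨S, hS, hcard⟩ := h.exists_fan_of_arc hw hl
  exact ⟨l, S, hl, hmin, fun e he => (hS e he).2, hcard⟩

theorem exists_right_fan (h : IsPeripheralSystem N J) {w : ℤ → ℤ} (hw : IsAdditive J w) (p : ℤ) :
    ∃ (r : ℤ) (S : Finset (ℤ × ℤ)), J p r ∧ (∀ k, J p k → k ≤ r) ∧
      (∀ e ∈ S, J e.1 e.2 ∧ J p e.1 ∧ J p e.2) ∧ w (p + 1) = w r + S.card * w p := by
  obtain ⟨l, S, hl, hmin, hS, hcard⟩ := h.neg.exists_left_fan (w := fun i => w (-i))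
    (fun i p j hip hpj hij => (hw hpj hip hij).trans (add_comm _ _)) (-p)
  let reflect : ℤ × ℤ ↪ ℤ × ℤ :=
    ((Equiv.prodComm ℤ ℤ).trans ((Equiv.neg ℤ).prodCongr (Equiv.neg ℤ))).toEmbedding
  refine ⟨-l, S.map reflect, by simpa using hl, fun k hk => ?_, ?_, by simpa [add_comm] using hcard⟩
  · exact le_neg_of_le_neg (hmin (-k) (by simpa using hk))
  · rw [Finset.forall_mem_map]
    intro e he
    have := hS e he
    rw [neg_neg] at this
    exact ⟨this.1, this.2.2, this.2.1⟩

theorem exists_fans (h : IsPeripheralSystem N J) {w : ℤ → ℤ} (hw : IsAdditive J w) (p : ℤ) :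
    ∃ (l r : ℤ) (S : Finset (ℤ × ℤ)), J l p ∧ (∀ k, J k p → l ≤ k) ∧ J p r ∧
      (∀ k, J p k → k ≤ r) ∧ (∀ e ∈ S, e ∈ link J p ∧ e ≠ (l, r)) ∧
      w (p - 1) + w (p + 1) = w l + w r + S.card * w p := by
  obtain ⟨l, L, hl, hmin, hL, hLcard⟩ := h.exists_left_fan hw p
  obtain ⟨r, R, hr, hmax, hR, hRcard⟩ := h.exists_right_fan hw p
  have hdisj : Disjoint L R := Finset.disjoint_left.2 fun e heL heR =>
    (h.lt (hL e heL).2.1).asymm (h.lt (hR e heR).2.1)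
  refine ⟨l, r, L ∪ R, hl, hmin, hr, hmax, fun e he => ?_, ?_⟩
  · rcases Finset.mem_union.1 he with he | he
    · refine ⟨⟨(hL e he).1, Or.inl (hL e he).2.1, Or.inl (hL e he).2.2⟩, ?_⟩
      rintro rfl
      exact (h.lt hr).asymm (h.lt (hL _ he).2.2)
    · refine ⟨⟨(hR e he).1, Or.inr (hR e he).2.1, Or.inr (hR e he).2.2⟩, ?_⟩
      rintro rfl
      exact (h.lt hl).asymm (h.lt (hR _ he).2.1)
  · rw [Finset.card_union_of_disjoint hdisj, hLcard, hRcard]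
    push_cast
    ring

theorem weight_add_weight_le_of_nonempty (h : IsPeripheralSystem N J)
    (hp : (arcsOver J p).Nonempty) :
    h.weight (p - 1) + h.weight (p + 1) ≤ (link J p).ncard * h.weight p := by
  obtain ⟨l, r, S, hl, hmin, hr, hmax, hS, hcard⟩ := h.exists_fans h.isAdditive_weight p
  obtain ⟨⟨i, j⟩, hij, hi, hj⟩ := hp
  obtain ⟨i, j, hip, hpj, hij⟩ := h.exists_apex hij hi hj
  have hi := h.lt hip
  have hj := h.lt hpj
  obtain rfl : l = i := (hmin i hip).antisymm <| not_lt.1 fun hli =>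
    (h.noncrossing hl hij hli hi).not_gt hj
  obtain rfl : r = j := (h.noncrossing hij hr hi hj).antisymm (hmax j hpj)
  have hmem : (l, r) ∉ S := fun hlr => (hS _ hlr).2 rfl
  have hle : (insert (l, r) S).card ≤ (link J p).ncard := by
    rw [← Set.ncard_coe_finset]
    refine Set.ncard_le_ncard ?_ (h.finite_link p)
    rw [Finset.coe_insert, Set.insert_subset_iff]
    exact ⟨⟨hij, Or.inl hl, Or.inr hr⟩, fun e he => (hS e he).1⟩
  calc h.weight (p - 1) + h.weight (p + 1) = (insert (l, r) S).card * h.weight p := by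
        rw [hcard, ← h.isAdditive_weight hl hr hij, Finset.card_insert_of_notMem hmem]
        push_cast
        ring
    _ ≤ _ := mul_le_mul_of_nonneg_right (by exact_mod_cast hle) (h.weight_pos p).le

theorem weight_add_weight_le_of_eq_empty (h : IsPeripheralSystem N J) (hp : arcsOver J p = ∅) :
    ∃ l r, J l p ∧ J p r ∧ arcsOver J l = ∅ ∧ arcsOver J r = ∅ ∧
      h.weight (p - 1) + h.weight (p + 1) ≤ ((link J p).ncard + 2) * h.weight p := by
  obtain ⟨l, r, S, hl, hmin, hr, hmax, hS, hcard⟩ := h.exists_fans h.isAdditive_weight p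
  have hlp := h.lt hl
  have hpr := h.lt hr
  have hnot : ∀ {i j}, J i j → i < p → ¬ p < j := fun {i j} hij hi hj =>
    hp.subset (show (i, j) ∈ arcsOver J p from ⟨hij, hi, hj⟩)
  have hl0 : arcsOver J l = ∅ := by
    refine Set.eq_empty_iff_forall_notMem.2 ?_
    rintro ⟨i, j⟩ ⟨hij, hi, hj⟩
    rcases (h.noncrossing hij hl hi hj).eq_or_lt with rfl | hpj
    · exact (hmin i hij).not_gt hi
    · exact hnot hij (hi.trans hlp) hpj
  have hr0 : arcsOver J r = ∅ := by
    refine Set.eq_empty_iff_forall_notMem.2 ?_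
    rintro ⟨i, j⟩ ⟨hij, hi, hj⟩
    rcases lt_trichotomy i p with hip | rfl | hip
    · exact hnot hij hip (hpr.trans hj)
    · exact (hmax j hij).not_gt hj
    · exact (h.noncrossing hr hij hip hi).not_gt hj
  have hle : S.card ≤ (link J p).ncard := by
    rw [← Set.ncard_coe_finset]
    exact Set.ncard_le_ncard (fun e he => (hS e he).1) (h.finite_link p)
  refine ⟨l, r, hl, hr, hl0, hr0, ?_⟩
  rw [hcard, h.weight_of_arcsOver_eq_empty hp, h.weight_of_arcsOver_eq_empty hl0,
    h.weight_of_arcsOver_eq_empty hr0]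
  omega

end IsPeripheralSystem

/-! ## The edges of a triangulation at the lower boundary -/

section Shift

variable {n : ℤ}

theorem exists_lt_add_mul (hn : 0 < n) (i a : ℤ) : ∃ j : ℤ, a < i + j * n :=
  ⟨(a - i) / n + 1, sub_lt_iff_lt_add'.1 (Int.lt_ediv_add_one_mul_self _ hn)⟩

theorem exists_add_mul_lt (hn : 0 < n) (i a : ℤ) : ∃ j : ℤ, i + j * n < a := by
  obtain ⟨j, hj⟩ := exists_lt_add_mul hn (-i) (-a)
  exact ⟨-j, by linarith⟩

theorem eq_zero_or_le_mul (hn : 0 < n) (j : ℤ) : j = 0 ∨ j * n ≤ -n ∨ n ≤ j * n := by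
  rcases lt_trichotomy j 0 with hj | hj | hj
  · exact Or.inr (Or.inl (by nlinarith))
  · exact Or.inl hj
  · exact Or.inr (Or.inr (le_mul_of_one_le_left hn.le hj))

end Shift

section Lower

open Vertex

variable {n m : ℕ} {T : Set (Arc n m)} {i j k l p q : ℤ} {u v y e : Vertex}

theorem Edge.exists_lower (hn : 0 < n) (hT : T.Pairwise Compatible)
    (h : Edge T (.lower i) (.lower j)) (h' : Edge T (.lower k) y) (hi : i < k) (hj : k < j) :
    ∃ l, y = .lower l ∧ i ≤ l ∧ l ≤ j := by
  have hsep := h.not_separates hn hT h'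
  cases y <;> simp [Separates, Between, Outside, Before] at hsep ⊢ <;> omega

theorem Edge.le_add (hn : 0 < n) (hT : T.Pairwise Compatible)
    (h : Edge T (.lower i) (.lower j)) : j ≤ i + n := by
  by_contra! hj
  have hshift : Edge T (.lower (i + n)) (.lower (j + n)) := by
    simpa only [Vertex.shift, one_mul] using h.shift 1
  obtain ⟨l, hl, -, hlj⟩ := h.exists_lower hn hT hshift (by omega) hj
  have := lower.inj hl
  omega

theorem joined_comm : Joined T u v ↔ Joined T v u :=
  or_congr boundarySegment_comm edge_comm

/-- The arcs of `T` and the boundary segments at the lower boundary, given by their ends. -/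
def LowerJoined (T : Set (Arc n m)) (i j : ℤ) : Prop := i < j ∧ Joined T (.lower i) (.lower j)

theorem lowerJoined_of_edge (h : Edge T (.lower i) (.lower j)) (hij : i < j) : LowerJoined T i j :=
  ⟨hij, Or.inr h⟩

theorem lowerJoined_succ (i : ℤ) : LowerJoined T i (i + 1) :=
  ⟨lt_add_one i, Or.inl (Or.inl rfl)⟩

theorem LowerJoined.eq_or_edge (h : LowerJoined T i j) :
    j = i + 1 ∨ Edge T (.lower i) (.lower j) := by
  obtain ⟨hij, (hseg | hseg) | hedge⟩ := h
  · exact Or.inl hseg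
  · omega
  · exact Or.inr hedge

theorem LowerJoined.le_add (hn : 0 < n) (hT : T.Pairwise Compatible) (h : LowerJoined T i j) :
    j ≤ i + n := by
  rcases h.eq_or_edge with rfl | hE
  · omega
  · exact hE.le_add hn hT

theorem LowerJoined.exists_lower (hn : 0 < n) (hT : T.Pairwise Compatible) (h : LowerJoined T i j)
    (h' : Edge T (.lower k) y) (hi : i < k) (hj : k < j) : ∃ l, y = .lower l ∧ i ≤ l ∧ l ≤ j := by
  rcases h.eq_or_edge with rfl | hE
  · omega
  · exact hE.exists_lower hn hT h' hi hj

theorem LowerJoined.noncrossing (hn : 0 < n) (hT : T.Pairwise Compatible) (h : LowerJoined T i j)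
    (h' : LowerJoined T k l) (hik : i < k) (hkj : k < j) : l ≤ j := by
  rcases h'.eq_or_edge with rfl | hE
  · omega
  · obtain ⟨l', hl, -, hlj⟩ := h.exists_lower hn hT hE hik hkj
    rwa [lower.inj hl]

theorem edge_lower_of_greatest (hn : 0 < n) (hT : IsTriangulation T)
    (hE : Edge T (.lower i) (.lower j)) (hr : LowerJoined T i p) (hpj : p + 1 < j)
    (hmax : ∀ k, LowerJoined T i k ∧ k < j → k ≤ p) : Edge T (.lower p) (.lower j) := by
  have hip := hr.1
  have hle := hE.le_add hn hT.1
  refine edge_of_not_outside hn hT ⟨Or.inl ⟨trivial, trivial⟩, ?_, ?_⟩ (fun a => ?_) ?_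
  · exact fun h => by have := lower.inj h; omega
  · rintro (h | h) <;> omega
  · rcases eq_zero_or_le_mul (n := n) (by omega) a with rfl | ha | ha <;>
      simp only [Separates, Between, Outside, Before, Vertex.shift] <;> omega
  intro x y hxy hx hy
  obtain ⟨k, rfl, hpk, hkj⟩ : ∃ k, x = .lower k ∧ p < k ∧ k < j := by
    cases x <;> simp [Between, Before] at hx ⊢
    omega
  obtain ⟨l, rfl, hil, hlj⟩ := hE.exists_lower hn hT.1 hxy (by omega) hkj
  have hlp : l < p := by
    simp only [Outside, Before] at hy
    omega
  rcases hil.eq_or_lt with rfl | hil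
  · exact (hmax k ⟨lowerJoined_of_edge hxy.symm (by omega), hkj⟩).not_gt hpk
  · obtain ⟨k', hk', -, hkp⟩ := hr.exists_lower hn hT.1 hxy.symm hil hlp
    have := lower.inj hk'
    omega

theorem isPeripheralSystem_lowerJoined (hn : 0 < n) (hT : IsTriangulation T) :
    IsPeripheralSystem n (LowerJoined T) where
  lt h := h.1
  le_add h := h.le_add hn hT.1
  segment := lowerJoined_succ
  noncrossing h := h.noncrossing hn hT.1
  exists_triangle {i j} h hij := by
    have hE : Edge T (.lower i) (.lower j) := h.eq_or_edge.resolve_left hij.ne'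
    obtain ⟨r, ⟨hr, hrj⟩, hmax⟩ := Int.exists_greatest_of_bdd
      (P := fun r => LowerJoined T i r ∧ r < j) ⟨j, fun z hz => hz.2.le⟩
      ⟨i + 1, lowerJoined_succ i, hij⟩
    refine ⟨r, hr, ?_⟩
    rcases (Int.add_one_le_of_lt hrj).eq_or_lt with rfl | hrj'
    · exact lowerJoined_succ r
    · exact lowerJoined_of_edge (edge_lower_of_greatest hn hT hE hr hrj' hmax) hrj

theorem not_edge_of_arcsOver_eq_empty (hp : arcsOver (LowerJoined T) p = ∅) (hi : i < p)
    (hj : p < j) : ¬ Edge T (.lower i) (.lower j) := fun h =>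
  hp.subset (show (i, j) ∈ arcsOver _ p from ⟨lowerJoined_of_edge h (hi.trans hj), hi, hj⟩)

/-! ### Bridging and asymptotic arcs -/

theorem Edge.pos_of_upper (h : Edge T u (.upper k)) : 0 < (m : ℤ) := by
  have : m ≠ 0 := by simpa [IsMarked, IsInfinite] using h.isArcPair.symm.valid_left
  omega

theorem Edge.upper_le_upper (hn : 0 < n) (hT : T.Pairwise Compatible)
    (h : Edge T (.lower i) (.upper k)) (h' : Edge T (.lower j) (.upper l)) (hij : i < j) :
    k ≤ l := by
  have hsep := h.not_separates hn hT h'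
  simp [Separates, Between, Outside, Before] at hsep
  omega

theorem Edge.not_edge_of_isInfinite (hn : 0 < n) (hT : T.Pairwise Compatible)
    (h : Edge T (.lower i) (.upper k)) (he : e.IsInfinite) : ¬ Edge T u e := by
  intro h'
  have hu : u.IsMarked m := by
    have hends := h'.isArcPair.ends
    cases e <;> simp_all [IsMarked, IsInfinite]
  have hsep := fun j => (h.shift j).not_separates hn hT h'
  have hn' : 0 < (n : ℤ) := by exact_mod_cast hn
  cases u with
  | lower a =>
    obtain ⟨j₁, h₁⟩ := exists_lt_add_mul hn' i a
    obtain ⟨j₂, h₂⟩ := exists_add_mul_lt hn' i a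
    have h₁' := hsep j₁
    have h₂' := hsep j₂
    cases e <;> simp_all [Separates, Between, Outside, Before, Vertex.shift, IsInfinite]
  | upper a =>
    obtain ⟨j₁, h₁⟩ := exists_lt_add_mul h.pos_of_upper k a
    obtain ⟨j₂, h₂⟩ := exists_add_mul_lt h.pos_of_upper k a
    have h₁' := hsep j₁
    have h₂' := hsep j₂
    cases e <;> simp_all [Separates, Between, Outside, Before, Vertex.shift, IsInfinite]
  | posInf => exact hu
  | negInf => exact hu

theorem Edge.not_edge_negInf (hn : 0 < n) (hT : T.Pairwise Compatible)
    (h : Edge T (.lower i) .posInf) : ¬ Edge T (.lower k) .negInf := by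
  intro h'
  obtain ⟨j, hj⟩ := exists_add_mul_lt (n := n) (by exact_mod_cast hn) i k
  have hsep := (h.shift j).not_separates hn hT h'
  simp [Separates, Between, Outside, Before, Vertex.shift] at hsep
  omega

theorem Edge.eq_of_isInfinite (hn : 0 < n) (hT : T.Pairwise Compatible) (h : Edge T (.lower i) u)
    (hu : u.IsInfinite) (h' : Edge T (.lower k) v) (hv : v.IsInfinite) : u = v := by
  cases u <;> cases v <;> first
    | rfl
    | exact hu.elim
    | exact hv.elim
    | exact (h.not_edge_negInf hn hT h').elim
    | exact (h'.not_edge_negInf hn hT h).elim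

theorem edge_of_isInfinite (hn : 0 < n) (hT : IsTriangulation T) (he : e.IsInfinite)
    (hp : arcsOver (LowerJoined T) p = ∅) (hb : ∀ i k, ¬ Edge T (.lower i) (.upper k))
    (heq : ∀ i u, Edge T (.lower i) u → u.IsInfinite → u = e) : Edge T (.lower p) e := by
  have hne : ∀ k, e ≠ .lower k := by rintro k rfl; exact he
  refine edge_of_not_outside hn hT ⟨Or.inr (Or.inl ⟨trivial, he⟩), (hne p).symm, ?_⟩
    (fun a => ?_) ?_
  · cases e <;> simp_all [BoundarySegment]
  · cases e <;> simp_all [Separates, Between, Outside, Before, Vertex.shift, IsInfinite]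
  intro x y hxy hx hy
  obtain ⟨k, rfl⟩ : ∃ k, x = .lower k := by
    cases e <;> cases x <;> simp_all [Between, Before, IsInfinite]
  cases y with
  | lower l =>
    have hkl := fun h h' => not_edge_of_arcsOver_eq_empty (i := k) (j := l) hp h h' hxy
    have hlk := fun h h' => not_edge_of_arcsOver_eq_empty (i := l) (j := k) hp h h' hxy.symm
    cases e <;> simp [Between, Outside, Before, IsInfinite] at he hx hy
    · exact hlk (by omega) (by omega)
    · exact hkl (by omega) (by omega)
  | upper l => exact hb _ _ hxy
  | posInf =>
    obtain rfl := heq _ _ hxy trivial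
    simp [Outside, Before] at hy
  | negInf =>
    obtain rfl := heq _ _ hxy trivial
    simp [Outside, Before] at hy

theorem not_separates_shift_lower_upper (hn : 0 < (n : ℤ)) (hm : 0 < (m : ℤ)) (q k j : ℤ) :
    ¬ (lower q).Separates (.upper k) ((lower q).shift n m j) ((upper k).shift n m j) := by
  have hj : j * n = 0 ∧ j * m = 0 ∨ j * n < 0 ∧ j * m < 0 ∨ 0 < j * n ∧ 0 < j * m := by
    rcases lt_trichotomy j 0 with h | rfl | h
    · exact Or.inr (Or.inl ⟨mul_neg_of_neg_of_pos h hn, mul_neg_of_neg_of_pos h hm⟩)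
    · exact Or.inl ⟨zero_mul _, zero_mul _⟩
    · exact Or.inr (Or.inr ⟨mul_pos h hn, mul_pos h hm⟩)
  simp [Separates, Between, Outside, Before, Vertex.shift]
  omega

theorem edge_upper (hn : 0 < n) (hT : IsTriangulation T) (hq : arcsOver (LowerJoined T) q = ∅)
    (h : Edge T (.lower p) (.upper k)) (hpq : p ≤ q)
    (hmax : ∀ a b, a < q → Edge T (.lower a) (.upper b) → b ≤ k) :
    Edge T (.lower q) (.upper k) := by
  have hm := h.pos_of_upper
  refine edge_of_not_outside hn hT ⟨Or.inl ⟨trivial, show m ≠ 0 by omega⟩, by simp, id⟩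
    (not_separates_shift_lower_upper (by omega) hm q k) ?_
  intro a b hab ha hb
  cases a with
  | posInf => simp [Between, Before] at ha
  | negInf => exact h.not_edge_of_isInfinite (e := .negInf) hn hT.1 trivial hab.symm
  | lower a =>
    have haq : a < q := by simpa [Between, Before] using ha
    cases b with
    | negInf => simp [Outside, Before] at hb
    | posInf => exact h.not_edge_of_isInfinite (e := .posInf) hn hT.1 trivial hab
    | lower b =>
      have hqb : q < b := by simpa [Outside, Before] using hb
      exact not_edge_of_arcsOver_eq_empty hq haq hqb hab
    | upper b => exact (hmax a b haq hab).not_gt (by simpa [Outside, Before] using hb)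
  | upper a =>
    have hak : a < k := by simpa [Between, Before] using ha
    cases b with
    | negInf => simp [Outside, Before] at hb
    | posInf => exact h.not_edge_of_isInfinite (e := .posInf) hn hT.1 trivial hab
    | lower b =>
      have hqb : q < b := by simpa [Outside, Before] using hb
      exact (h.upper_le_upper hn hT.1 hab.symm (hpq.trans_lt hqb)).not_gt hak
    | upper b =>
      have hsep := h.not_separates hn hT.1 hab
      simp [Separates, Between, Outside, Before] at hsep hb
      omega

theorem exists_edge_upper (hn : 0 < n) (hT : IsTriangulation T) (h : LowerJoined T l p)
    (hl : arcsOver (LowerJoined T) l = ∅) (hp : arcsOver (LowerJoined T) p = ∅)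
    (hik : Edge T (.lower i) (.upper k)) :
    ∃ k, Edge T (.lower l) (.upper k) ∧ Edge T (.lower p) (.upper k) := by
  obtain ⟨j, hj⟩ := exists_add_mul_lt (n := n) (by omega) i l
  obtain ⟨j', hj'⟩ := exists_lt_add_mul (n := n) (by omega) i l
  obtain ⟨k, ⟨x, hxl, hxk⟩, hmax⟩ := Int.exists_greatest_of_bdd
    (P := fun k => ∃ x ≤ l, Edge T (.lower x) (.upper k))
    ⟨k + j' * m, fun z ⟨x, hx, hxz⟩ =>
      hxz.upper_le_upper hn hT.1 (hik.shift j') (hx.trans_lt hj')⟩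
    ⟨k + j * m, i + j * n, hj.le, hik.shift j⟩
  refine ⟨k, edge_upper hn hT hl hxk hxl fun a b ha hab => hmax b ⟨a, ha.le, hab⟩,
    edge_upper hn hT hp hxk (hxl.trans h.1.le) fun a b ha hab => ?_⟩
  rcases le_or_gt a l with hal | hal
  · exact hmax b ⟨a, hal, hab⟩
  · obtain ⟨c, hc, -⟩ := h.exists_lower hn hT.1 hab hal ha
    exact nomatch hc

theorem exists_triangle_above (hn : 0 < n) (hT : IsTriangulation T) (h : LowerJoined T l p)
    (hl : arcsOver (LowerJoined T) l = ∅) (hp : arcsOver (LowerJoined T) p = ∅) :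
    ∃ z : Vertex, (∀ k, z ≠ .lower k) ∧ Edge T (.lower l) z ∧ Edge T (.lower p) z := by
  by_cases hb : ∃ i k, Edge T (.lower i) (.upper k)
  · obtain ⟨i, k, hik⟩ := hb
    obtain ⟨k, hlk, hpk⟩ := exists_edge_upper hn hT h hl hp hik
    exact ⟨.upper k, by simp, hlk, hpk⟩
  push Not at hb
  suffices ∃ e : Vertex, e.IsInfinite ∧ ∀ i u, Edge T (.lower i) u → u.IsInfinite → u = e by
    obtain ⟨e, he, heq⟩ := this
    exact ⟨e, by rintro k rfl; exact he, edge_of_isInfinite hn hT he hl hb heq,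
      edge_of_isInfinite hn hT he hp hb heq⟩
  by_cases hinf : ∃ i e, Edge T (.lower i) e ∧ e.IsInfinite
  · obtain ⟨i, e, hie, he⟩ := hinf
    exact ⟨e, he, fun _ _ hu hu' => hu.eq_of_isInfinite hn hT.1 hu' hie he⟩
  · push Not at hinf
    exact ⟨.posInf, trivial, fun i u hu hu' => absurd hu' (hinf i u hu)⟩

end Lower

/-! ## Counting triangles -/

section Counting

open Vertex

variable {n m : ℕ} {T : Set (Arc n m)} {p l r : ℤ} {u v w : Vertex}

theorem finite_upper_neighbors (hn : 0 < n) (hT : T.Pairwise Compatible) (p : ℤ) :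
    {k | Edge T (.lower p) (.upper k)}.Finite := by
  rcases Set.eq_empty_or_nonempty {k | Edge T (.lower p) (.upper k)} with h | ⟨k, hk⟩
  · exact h ▸ Set.finite_empty
  have hk : Edge T (.lower p) (.upper k) := hk
  refine (Set.finite_Icc (k + -1 * m) (k + 1 * m)).subset fun l hl => ⟨?_, ?_⟩
  · exact (hk.shift (-1)).upper_le_upper hn hT hl (by omega)
  · exact Edge.upper_le_upper hn hT hl (hk.shift 1) (by omega)

theorem finite_joined (hn : 0 < n) (hT : T.Pairwise Compatible) (p : ℤ) :
    {v | Joined T (.lower p) v}.Finite := by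
  refine ((((Set.finite_Icc (p - n) (p + n)).image lower).union
    ((finite_upper_neighbors hn hT p).image upper)).union
    (Set.toFinite {posInf, negInf})).subset fun v (hv : Joined T (.lower p) v) => ?_
  cases v with
  | lower k =>
    refine Or.inl (Or.inl ⟨k, ?_, rfl⟩)
    rcases lt_trichotomy p k with hk | rfl | hk
    · exact ⟨by omega, LowerJoined.le_add hn hT ⟨hk, hv⟩⟩
    · exact ⟨by omega, by omega⟩
    · have := LowerJoined.le_add hn hT ⟨hk, joined_comm.1 hv⟩
      exact ⟨by omega, by omega⟩
  | upper k => exact Or.inl (Or.inr ⟨k, hv.resolve_left id, rfl⟩)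
  | posInf => exact Or.inr (Or.inl rfl)
  | negInf => exact Or.inr (Or.inr rfl)

theorem finite_trianglesAt (hn : 0 < n) (hT : T.Pairwise Compatible) (p : ℤ) :
    (trianglesAt T (.lower p)).Finite := by
  have h := ((finite_joined hn hT p).insert (.lower p)).finite_subsets
  refine (h.preimage Finset.coe_injective.injOn).subset fun t ht v hv => ?_
  by_cases hvp : v = .lower p
  · exact Or.inl hvp
  · exact Or.inr (ht.2.2 ht.2.1 hv (Ne.symm hvp))

open Classical in
theorem mem_trianglesAt (huv : u ≠ v) (huw : u ≠ w) (hvw : v ≠ w)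
    (h : Joined T u v) (h' : Joined T u w) (h'' : Joined T v w) :
    ({u, v, w} : Finset Vertex) ∈ trianglesAt T u := by
  refine ⟨Finset.card_eq_three.2 ⟨u, v, w, huv, huw, hvw, rfl⟩, by simp, ?_⟩
  have : Std.Symm (Joined T) := ⟨fun _ _ => joined_comm.1⟩
  simp [Set.pairwise_insert_of_symm, h, h', h'']

/-- The triangles at `lower p` whose vertices lie on the lower boundary. -/
def lowerTriangles (T : Set (Arc n m)) (p : ℤ) : Set (Finset Vertex) :=
  {t ∈ trianglesAt T (.lower p) | ∀ v ∈ t, ∃ k, v = .lower k}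

open Classical in
theorem mem_lowerTriangles {e : ℤ × ℤ} (he : e ∈ link (LowerJoined T) p) :
    ({.lower p, .lower e.1, .lower e.2} : Finset Vertex) ∈ lowerTriangles T p := by
  obtain ⟨h, h₁, h₂⟩ := he
  have joined_of_or : ∀ {k}, LowerJoined T k p ∨ LowerJoined T p k →
      Vertex.lower p ≠ .lower k ∧ Joined T (.lower p) (.lower k) := by
    rintro k (hk | hk)
    · exact ⟨fun h => hk.1.ne' (lower.inj h), joined_comm.1 hk.2⟩
    · exact ⟨fun h => hk.1.ne (lower.inj h), hk.2⟩
  exact ⟨mem_trianglesAt (joined_of_or h₁).1 (joined_of_or h₂).1 (fun h' => h.1.ne (lower.inj h'))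
    (joined_of_or h₁).2 (joined_of_or h₂).2 h.2, by simp⟩

theorem finite_lowerTriangles (hn : 0 < n) (hT : T.Pairwise Compatible) (p : ℤ) :
    (lowerTriangles T p).Finite :=
  (finite_trianglesAt hn hT p).subset (Set.sep_subset _ _)

theorem ncard_link_le (hn : 0 < n) (hT : T.Pairwise Compatible) (p : ℤ) :
    (link (LowerJoined T) p).ncard ≤ (lowerTriangles T p).ncard := by
  classical
  refine Set.ncard_le_ncard_of_injOn (fun e => {.lower p, .lower e.1, .lower e.2})
    (fun e he => mem_lowerTriangles he) ?_ (finite_lowerTriangles hn hT p)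
  rintro ⟨i, j⟩ ⟨hij, hi, hj⟩ ⟨k, l⟩ ⟨hkl, hk, hl⟩ heq
  have hmem : ∀ x, (x = p ∨ x = i ∨ x = j) ↔ (x = p ∨ x = k ∨ x = l) := fun x => by
    simpa using Finset.ext_iff.1 heq (.lower x)
  have hne : ∀ {x}, LowerJoined T x p ∨ LowerJoined T p x → x ≠ p := by
    rintro x (hx | hx)
    exacts [hx.1.ne, hx.1.ne']
  have := hij.1
  have := hkl.1
  have := hne hi
  have := hne hj
  have := hne hk
  have := hne hl
  have := hmem i
  have := hmem j
  have := hmem k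
  have := hmem l
  simp only [Prod.mk.injEq]
  omega

theorem ncard_lowerTriangles_le (hn : 0 < n) (hT : T.Pairwise Compatible) (p : ℤ) :
    (lowerTriangles T p).ncard ≤ (trianglesAt T (.lower p)).ncard :=
  Set.ncard_le_ncard (Set.sep_subset _ _) (finite_trianglesAt hn hT p)

theorem ncard_lowerTriangles_add_two_le (hn : 0 < n) (hT : IsTriangulation T)
    (hlp : LowerJoined T l p) (hpr : LowerJoined T p r) (hl : arcsOver (LowerJoined T) l = ∅)
    (hp : arcsOver (LowerJoined T) p = ∅) (hr : arcsOver (LowerJoined T) r = ∅) :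
    (lowerTriangles T p).ncard + 2 ≤ (trianglesAt T (.lower p)).ncard := by
  classical
  obtain ⟨y, hy, hly, hpy⟩ := exists_triangle_above hn hT hlp hl hp
  obtain ⟨z, hz, hpz, hrz⟩ := exists_triangle_above hn hT hpr hp hr
  have hfin := finite_lowerTriangles hn hT.1 p
  have hyz : ({.lower p, .lower l, y} : Finset Vertex) ≠ {.lower p, .lower r, z} := fun h => by
    have hl : Vertex.lower l ∈ ({.lower p, .lower r, z} : Finset Vertex) := h ▸ by simp
    have := hlp.1
    have := hpr.1
    have := hz l
    grind
  have hpair : ({{.lower p, .lower l, y}, {.lower p, .lower r, z}} : Set (Finset Vertex)) ⊆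
      trianglesAt T (.lower p) := by
    rintro t (rfl | rfl)
    · exact mem_trianglesAt (by simpa using hlp.1.ne') (hy p).symm (hy l).symm
        (joined_comm.1 hlp.2) (Or.inr hpy) (Or.inr hly)
    · exact mem_trianglesAt (by simpa using hpr.1.ne) (hz p).symm (hz r).symm
        hpr.2 (Or.inr hpz) (Or.inr hrz)
  have hdisj : Disjoint (lowerTriangles T p)
      {{.lower p, .lower l, y}, {.lower p, .lower r, z}} := by
    refine Set.disjoint_right.2 ?_
    rintro t (rfl | rfl) ⟨-, ht⟩
    · obtain ⟨k, hk⟩ := ht y (by simp)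
      exact hy k hk
    · obtain ⟨k, hk⟩ := ht z (by simp)
      exact hz k hk
  rw [← Set.ncard_pair hyz, ← Set.ncard_union_eq hdisj hfin (Set.toFinite _)]
  exact Set.ncard_le_ncard (Set.union_subset (Set.sep_subset _ _) hpair)
    (finite_trianglesAt hn hT.1 p)

theorem weight_add_weight_le (hn : 0 < n) (hT : IsTriangulation T) (p : ℤ) :
    (isPeripheralSystem_lowerJoined hn hT).weight (p - 1) +
        (isPeripheralSystem_lowerJoined hn hT).weight (p + 1) ≤
      (trianglesAt T (.lower p)).ncard * (isPeripheralSystem_lowerJoined hn hT).weight p := by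
  have h := isPeripheralSystem_lowerJoined hn hT
  have hlink := ncard_link_le hn hT.1 p
  rcases (arcsOver (LowerJoined T) p).eq_empty_or_nonempty with hp | hp
  · obtain ⟨l, r, hl, hr, hl0, hr0, hle⟩ := h.weight_add_weight_le_of_eq_empty hp
    have := ncard_lowerTriangles_add_two_le hn hT hl hr hl0 hp hr0
    exact hle.trans (mul_le_mul_of_nonneg_right (by omega) (h.weight_pos p).le)
  · have := ncard_lowerTriangles_le hn hT.1 p
    exact (h.weight_add_weight_le_of_nonempty hp).trans
      (mul_le_mul_of_nonneg_right (by omega) (h.weight_pos p).le)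

theorem Joined.shift (h : Joined T u v) (j : ℤ) : Joined T (u.shift n m j) (v.shift n m j) :=
  h.imp boundarySegment_shift.2 fun h => Edge.shift h j

theorem map_shift_mem_trianglesAt {t : Finset Vertex} (ht : t ∈ trianglesAt T v) (j : ℤ) :
    t.map ⟨_, Vertex.shift_injective n m j⟩ ∈ trianglesAt T (v.shift n m j) := by
  refine ⟨by rw [Finset.card_map, ht.1], Finset.mem_map_of_mem _ ht.2.1, ?_⟩
  rw [Finset.coe_map]
  exact ((Vertex.shift_injective n m j).injOn.pairwise_image).2
    fun x hx y hy hxy => (ht.2.2 hx hy hxy).shift j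

theorem ncard_trianglesAt_shift (v : Vertex) (j : ℤ) :
    (trianglesAt T (v.shift n m j)).ncard = (trianglesAt T v).ncard := by
  rw [← Set.ncard_image_of_injective (trianglesAt T v)
    (Finset.map_injective ⟨_, Vertex.shift_injective n m j⟩)]
  congr 1
  refine Set.Subset.antisymm (fun t ht => ?_) (Set.image_subset_iff.2 fun t ht =>
    map_shift_mem_trianglesAt ht j)
  have hback := map_shift_mem_trianglesAt ht (-j)
  rw [Vertex.shift_shift, add_neg_cancel, Vertex.shift_zero] at hback
  refine ⟨_, hback, Finset.ext fun x => ?_⟩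
  simp [Vertex.shift_shift, Vertex.shift_zero]

end Counting

end AnnulusFrieze

end

theorem theorem3p7 (n m : ℕ) (hn : 0 < n) (T : Set (AnnulusFrieze.Arc n m))
    (hT : AnnulusFrieze.IsTriangulation T) :
    AnnulusFrieze.DefinesPeriodicInfiniteFrieze (AnnulusFrieze.quiddity T) := by
  have hJ := AnnulusFrieze.isPeripheralSystem_lowerJoined hn hT
  obtain ⟨F, hF, hquiddity⟩ := AnnulusFrieze.exists_isInfiniteFrieze
    (a := fun p => (AnnulusFrieze.trianglesAt T (.lower (p - 1))).ncard)
    (w := fun p => hJ.weight (p - 1)) (fun p => hJ.weight_pos _) fun p => by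
      simpa only [sub_add_eq_add_sub] using AnnulusFrieze.weight_add_weight_le hn hT (p - 1)
  refine ⟨F, hF, fun i => ?_, fun i => ?_⟩
  · have hshift : (i + n - 1 : ℤ) = i - 1 + 1 * n := by ring
    rw [hquiddity, hquiddity, hshift]
    exact congrArg _ (AnnulusFrieze.ncard_trianglesAt_shift (.lower (i - 1)) 1)
  · rw [hquiddity, add_sub_cancel_right]
    rfl
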